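/- Let $B>0$ and let $H_0=(-i\nabla-A)^2$, $A(x)=\left(-\tfrac{Bx_2}{2},\tfrac{Bx_1}{2}\right)$, be the Landau Hamiltonian, self-adjoint in $L^2(\mathbb{R}^2)$ (the closure of $(-i\nabla-A)^2$ from the Schwartz space). Let $\lambda_q=B(2q+1)$, $q=0,1,2,\ldots$, be its Landau levels, and write $\langle x\rangle=(1+|x|^2)^{1/2}$. Let $V:\mathbb{R}^2\to\mathbb{R}$ be bounded and continuous, and assume that for some $\rho\in(0,1)$ and some constant $c$ $$|V(x)|\le c\,\langle x\rangle^{-\rho},\qquad x\in\mathbb{R}^2 .$$ Let $H=H_0+V$, where $V$ acts by multiplication and $H$ has the domain of $H_0$. Then there exists a constant $C>0$ such that the spectrum of $H$ satisfies $$\sigma(H)\subset\bigcup_{q=0}^{\infty}\left(\lambda_q-C\lambda_q^{-\rho/2},\ \lambda_q+C\lambda_q^{-\rho/2}\right).$$ -/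

import Mathlib

open MeasureTheory Set
open scoped SchwartzMap BoundedContinuousFunction

noncomputable section

/-- The Euclidean plane `ℝ²`. -/
abbrev Plane : Type := EuclideanSpace ℝ (Fin 2)

/-- The complex Hilbert space `L²(ℝ²)`. -/
abbrev L2Plane : Type := Lp ℂ 2 (volume : Measure Plane)

/-- `⟨x⟩ = (1 + |x|²)^{1/2}`. -/
def japaneseBracket (x : Plane) : ℝ := Real.sqrt (1 + ‖x‖ ^ 2)

/-- The magnetic potential `A(x) = (-B x₂ / 2, B x₁ / 2)`, given by its two coordinates. -/
def magneticPotential (B : ℝ) (x : Plane) : Fin 2 → ℝ := ![-(B * x 1 / 2), B * x 0 / 2]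

/-- The `j`-th component `-i ∂ⱼ - Aⱼ` of the differential expression `-i∇ - A`. -/
def magneticMomentum (B : ℝ) (j : Fin 2) (u : Plane → ℂ) (x : Plane) : ℂ :=
  -Complex.I * fderiv ℝ u x (EuclideanSpace.single j 1) - (magneticPotential B x j : ℂ) * u x

/-- The differential expression `(-i∇ - A)² = ∑ⱼ (-i ∂ⱼ - Aⱼ)²`. -/
def landauExpr (B : ℝ) (u : Plane → ℂ) (x : Plane) : ℂ :=
  ∑ j : Fin 2, magneticMomentum B j (magneticMomentum B j u) x

theorem contDiff_magneticMomentum (B : ℝ) (j : Fin 2) {u : Plane → ℂ}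
    (hu : ContDiff ℝ (⊤ : ℕ∞) u) : ContDiff ℝ (⊤ : ℕ∞) (magneticMomentum B j u) := by
  have h1 : ContDiff ℝ (⊤ : ℕ∞) (fun x => fderiv ℝ u x (EuclideanSpace.single j 1)) :=
    (hu.fderiv_right (m := (⊤ : ℕ∞)) (by simp)).clm_apply contDiff_const
  have h2 : ContDiff ℝ (⊤ : ℕ∞) (fun x : Plane => (magneticPotential B x j : ℂ)) := by
    refine Complex.ofRealCLM.contDiff.comp ?_
    fin_cases j
    · change ContDiff ℝ (⊤ : ℕ∞) (fun x : Plane => -(B * x 1 / 2))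
      fun_prop
    · change ContDiff ℝ (⊤ : ℕ∞) (fun x : Plane => B * x 0 / 2)
      fun_prop
  unfold magneticMomentum
  exact (contDiff_const.mul h1).sub (h2.mul hu)

theorem magneticMomentum_add (B : ℝ) (j : Fin 2) {u v : Plane → ℂ}
    (hu : ContDiff ℝ (⊤ : ℕ∞) u) (hv : ContDiff ℝ (⊤ : ℕ∞) v) :
    magneticMomentum B j (u + v) = magneticMomentum B j u + magneticMomentum B j v := by
  funext x
  have h1 : DifferentiableAt ℝ u x := hu.differentiable (by simp) x
  have h2 : DifferentiableAt ℝ v x := hv.differentiable (by simp) x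
  simp only [magneticMomentum, Pi.add_apply, fderiv_add h1 h2, _root_.add_apply]
  ring

theorem magneticMomentum_smul (B : ℝ) (j : Fin 2) (c : ℂ) {u : Plane → ℂ}
    (hu : ContDiff ℝ (⊤ : ℕ∞) u) :
    magneticMomentum B j (c • u) = c • magneticMomentum B j u := by
  funext x
  have h1 : DifferentiableAt ℝ u x := hu.differentiable (by simp) x
  simp only [magneticMomentum, Pi.smul_apply, fderiv_const_smul h1, _root_.smul_apply,
    smul_eq_mul]
  ring

theorem contDiff_landauExpr (B : ℝ) {u : Plane → ℂ}
    (hu : ContDiff ℝ (⊤ : ℕ∞) u) : ContDiff ℝ (⊤ : ℕ∞) (landauExpr B u) :=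
  ContDiff.sum fun j _ =>
    contDiff_magneticMomentum B j (contDiff_magneticMomentum B j hu)

theorem landauExpr_add (B : ℝ) {u v : Plane → ℂ}
    (hu : ContDiff ℝ (⊤ : ℕ∞) u) (hv : ContDiff ℝ (⊤ : ℕ∞) v) :
    landauExpr B (u + v) = landauExpr B u + landauExpr B v := by
  funext x
  simp only [landauExpr, Pi.add_apply, ← Finset.sum_add_distrib]
  refine Finset.sum_congr rfl fun j _ => ?_
  rw [magneticMomentum_add B j hu hv, magneticMomentum_add B j
    (contDiff_magneticMomentum B j hu) (contDiff_magneticMomentum B j hv), Pi.add_apply]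

theorem landauExpr_smul (B : ℝ) (c : ℂ) {u : Plane → ℂ} (hu : ContDiff ℝ (⊤ : ℕ∞) u) :
    landauExpr B (c • u) = c • landauExpr B u := by
  funext x
  simp only [landauExpr, Pi.smul_apply, Finset.smul_sum]
  refine Finset.sum_congr rfl fun j _ => ?_
  rw [magneticMomentum_smul B j c hu, magneticMomentum_smul B j c
    (contDiff_magneticMomentum B j hu), Pi.smul_apply]

/-- The graph of `(-i∇ - A)²` on the Schwartz space, as a subspace of `L²(ℝ²) × L²(ℝ²)`. -/
def landauGraph (B : ℝ) : Submodule ℂ (L2Plane × L2Plane) where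
  carrier := {p | ∃ φ : 𝓢(Plane, ℂ), p.1 =ᵐ[volume] φ ∧ p.2 =ᵐ[volume] landauExpr B φ}
  zero_mem' := by
    refine ⟨0, ?_, ?_⟩
    · simpa using Lp.coeFn_zero ℂ 2 (volume : Measure Plane)
    · have h : landauExpr B (⇑(0 : 𝓢(Plane, ℂ))) = 0 := by
        have := landauExpr_smul B 0 (0 : 𝓢(Plane, ℂ)).smooth'
        simpa using this
      rw [h]
      exact Lp.coeFn_zero ℂ 2 (volume : Measure Plane)
  add_mem' := by
    rintro p r ⟨φ, h1, h2⟩ ⟨ψ, h3, h4⟩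
    refine ⟨φ + ψ, ?_, ?_⟩
    · exact (Lp.coeFn_add p.1 r.1).trans (h1.add h3)
    · have h : landauExpr B (⇑(φ + ψ)) = landauExpr B φ + landauExpr B ψ :=
        landauExpr_add B φ.smooth' ψ.smooth'
      rw [h]
      exact (Lp.coeFn_add p.2 r.2).trans (h2.add h4)
  smul_mem' := by
    rintro c p ⟨φ, h1, h2⟩
    refine ⟨c • φ, ?_, ?_⟩
    · exact (Lp.coeFn_smul c p.1).trans (h1.const_smul c)
    · have h : landauExpr B (⇑(c • φ)) = c • landauExpr B φ := landauExpr_smul B c φ.smooth'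
      rw [h]
      exact (Lp.coeFn_smul c p.2).trans (h2.const_smul c)

/-- `landauGraph B` is the graph of a function, so that `LinearPMap` may be built from it. -/
theorem landauGraph_functional (B : ℝ) (p : L2Plane × L2Plane) (hp : p ∈ landauGraph B)
    (h0 : p.1 = 0) : p.2 = 0 := by
  obtain ⟨φ, h1, h2⟩ := hp
  have h3 : (φ : Plane → ℂ) =ᵐ[volume] (0 : Plane → ℂ) := by
    refine h1.symm.trans ?_
    rw [h0]
    exact Lp.coeFn_zero ℂ 2 (volume : Measure Plane)
  have h4 : (φ : Plane → ℂ) = 0 :=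
    (Continuous.ae_eq_iff_eq volume φ.continuous continuous_zero).1 h3
  have h5 : landauExpr B (φ : Plane → ℂ) = 0 := by
    have := landauExpr_smul B 0 φ.smooth'
    rw [zero_smul, zero_smul] at this
    rw [h4]
    exact this
  rw [h5] at h2
  exact (Lp.eq_zero_iff_ae_eq_zero).2 h2

/-- `(-i∇ - A)²` with the Schwartz space as its domain, an operator in `L²(ℝ²)`. -/
def landauCore (B : ℝ) : L2Plane →ₗ.[ℂ] L2Plane := (landauGraph B).toLinearPMap

/-- The Landau Hamiltonian `H₀ = (-i∇ - A)²`, self-adjoint in `L²(ℝ²)`: the closure of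
`(-i∇ - A)²` from the Schwartz space, on which it is essentially self-adjoint. -/
def landauHamiltonian (B : ℝ) : L2Plane →ₗ.[ℂ] L2Plane := (landauCore B).closure

theorem memLp_potential_mul (V : Plane →ᵇ ℝ) (u : L2Plane) :
    MemLp (fun x => (V x : ℂ) * u x) 2 (volume : Measure Plane) := by
  refine MemLp.of_le_mul (c := ‖V‖) (Lp.memLp u) ?_ (Filter.Eventually.of_forall fun x => ?_)
  · exact (Complex.continuous_ofReal.comp V.continuous).aestronglyMeasurable.mul
      (Lp.aestronglyMeasurable u)
  · rw [norm_mul, Complex.norm_real]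
    exact mul_le_mul_of_nonneg_right (V.norm_coe_le_norm x) (norm_nonneg _)

/-- Multiplication by the bounded continuous real function `V` in `L²(ℝ²)`. -/
def potentialMul (V : Plane →ᵇ ℝ) : L2Plane →ₗ[ℂ] L2Plane where
  toFun u := (memLp_potential_mul V u).toLp _
  map_add' u v := by
    rw [← MemLp.toLp_add, MemLp.toLp_eq_toLp_iff]
    filter_upwards [Lp.coeFn_add u v] with x hx
    simp only [hx, Pi.add_apply, mul_add]
  map_smul' c u := by
    rw [RingHom.id_apply, ← MemLp.toLp_const_smul, MemLp.toLp_eq_toLp_iff]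
    filter_upwards [Lp.coeFn_smul c u] with x hx
    simp only [hx, Pi.smul_apply, smul_eq_mul]
    ring

/-- The perturbed operator `H = H₀ + V`, with the domain of `H₀`. -/
def perturbedLandau (B : ℝ) (V : Plane →ᵇ ℝ) : L2Plane →ₗ.[ℂ] L2Plane :=
  potentialMul V +ᵥ landauHamiltonian B

/-- The resolvent set of an operator `T` defined on a subspace of `E`: those `z` for which
`T - z` maps the domain of `T` bijectively onto `E`, with a bounded inverse `R`. -/
def operatorResolventSet {E : Type*} [NormedAddCommGroup E] [NormedSpace ℂ E]
    (T : E →ₗ.[ℂ] E) : Set ℂ :=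
  {z | ∃ R : E →L[ℂ] E,
    (∀ y : E, ∃ h : R y ∈ T.domain, T ⟨R y, h⟩ - z • R y = y) ∧
    (∀ x : T.domain, R (T x - z • (x : E)) = x)}

/-- The spectrum of an operator `T` defined on a subspace of `E`, a subset of `ℂ`. -/
def operatorSpectrum {E : Type*} [NormedAddCommGroup E] [NormedSpace ℂ E]
    (T : E →ₗ.[ℂ] E) : Set ℂ :=
  (operatorResolventSet T)ᶜ

/-- The Landau levels `λ_q = B (2 q + 1)`. -/
def landauLevel (B : ℝ) (q : ℕ) : ℝ := B * (2 * (q : ℝ) + 1)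

end

/-!
Write `H₀ = π₀² + π₁²` with `πⱼ = -i∂ⱼ - Aⱼ` and `[π₀, π₁] = iB`, and let `W = ⟨x⟩^{-ρ}`.

The heart of the matter is that a function `φ` with `‖(H₀ - z)φ‖ = O(1)` and `‖φ‖ = 1` satisfies
`⟨φ, Wφ⟩ = O(z^{-ρ/2})` (`exists_weightedMass_bracket_le`). Classically, a cyclotron orbit of energy
`z` has speed of order `√z` and radius of order `√z`, so it spends at most a fraction `O(R/√z)` of
its time in a disc of radius `R`. The quantum version (`weightedMass_radialWeight_le`) comes from
the virial identity `virial_identity`, the expectation of the commutator of `H₀` with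
`γπⱼ + πⱼγ` for the bounded function `γ = R arctan(xⱼ/R)`. Together with local conservation of
energy (`abs_weighted_energy_sub_le`), it bounds the kinetic energy in the `j`-th direction in the
strip `|xⱼ| ≲ R`; summing over `j` gives the total kinetic energy in the disc, which is `z` times
the mass there. A dyadic sum over `R ≤ √z`, which converges geometrically since `ρ < 1`, gives the
bound with the weight `W`.

Now let `u` satisfy `(H₀ + V - z)u = f` and let `v = sgn(H₀ - z)u`. If `z` has distance `d` from the
Landau levels, then `d‖u‖² ≤ ⟨v, (H₀ - z)u⟩ = ⟨v, f⟩ - ⟨v, Vu⟩`. When `‖f‖ ≤ ‖u‖`, both `u` and `v`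
are quasimodes as above, so that `|⟨v, Vu⟩| ≤ c ⟨v, Wv⟩^{1/2} ⟨u, Wu⟩^{1/2} = O(z^{-ρ/2})‖u‖²`.
Hence `H₀ + V - z` is bounded below once `d` exceeds a large multiple of `z^{-ρ/2}`
(`exists_lower_bound_on_landauSpan`).

The sign is available without a spectral theorem, because it suffices to take for `u` a finite
sum of Schwartz eigenfunctions. Their span `landauSpan B` is invariant under the ladder operators
`π₀ ± iπ₁` and under `-i∂ⱼ + Aⱼ`, hence under multiplication by the coordinates, and it contains a
Gaussian. So it contains all products of polynomials with this Gaussian and is dense in `L²`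
(`eq_zero_of_inner_landauSpan_eq_zero`). As `H₀ ≥ B > 0` maps it onto itself, it is a core, and the
closure of `H₀` is onto, hence self-adjoint. The lower bounds for `H₀ + V - z` then give a bounded
inverse (`exists_resolvent_of_lower_bound`).
-/

noncomputable section

open scoped LineDeriv ContDiff ComplexConjugate FourierTransform

/-! ### Operators on the Schwartz space -/

/-- The `j`-th coordinate of the plane as a complex-valued function. -/
def coordFun (j : Fin 2) (x : Plane) : ℂ := ((x j : ℝ) : ℂ)

theorem hasTemperateGrowth_coord (j : Fin 2) :
    Function.HasTemperateGrowth (fun x : Plane => x j) :=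
  (EuclideanSpace.proj (𝕜 := ℝ) j : Plane →L[ℝ] ℝ).hasTemperateGrowth

theorem hasTemperateGrowth_coordFun (j : Fin 2) : Function.HasTemperateGrowth (coordFun j) :=
  Function.HasTemperateGrowth.comp (f := fun x : Plane => x j) Function.Complex.hasTemperateGrowth_ofReal
    (hasTemperateGrowth_coord j)

/-- Multiplication by the `j`-th coordinate on the Schwartz space. -/
def coordMul (j : Fin 2) : Module.End ℂ 𝓢(Plane, ℂ) :=
  (SchwartzMap.smulLeftCLM ℂ (coordFun j)).toLinearMap

/-- The partial derivative `∂ⱼ` on the Schwartz space. -/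
def partialDeriv (j : Fin 2) : Module.End ℂ 𝓢(Plane, ℂ) :=
  (LineDeriv.lineDerivOpCLM ℂ 𝓢(Plane, ℂ) (EuclideanSpace.single j (1 : ℝ) : Plane)).toLinearMap

theorem coordMul_apply (j : Fin 2) (φ : 𝓢(Plane, ℂ)) (x : Plane) :
    coordMul j φ x = (x j : ℂ) * φ x := by
  simp [coordMul, SchwartzMap.smulLeftCLM_apply_apply (hasTemperateGrowth_coordFun j), coordFun]

theorem partialDeriv_apply (j : Fin 2) (φ : 𝓢(Plane, ℂ)) (x : Plane) :
    partialDeriv j φ x = fderiv ℝ φ x (EuclideanSpace.single j 1) := by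
  simp [partialDeriv, SchwartzMap.lineDerivOp_apply_eq_fderiv]

theorem coordMul_mul_coordMul (i j : Fin 2) :
    coordMul i * coordMul j = coordMul j * coordMul i := by
  ext φ x
  simp only [Module.End.mul_apply, coordMul_apply]
  ring

theorem partialDeriv_mul_partialDeriv (i j : Fin 2) :
    partialDeriv i * partialDeriv j = partialDeriv j * partialDeriv i := by
  ext φ x
  simp only [Module.End.mul_apply]
  have h : ∀ k l : Fin 2, partialDeriv k (partialDeriv l φ) x =
      fderiv ℝ (fderiv ℝ φ) x (EuclideanSpace.single k 1) (EuclideanSpace.single l 1) := by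
    intro k l
    rw [partialDeriv_apply]
    have : (⇑(partialDeriv l φ) : Plane → ℂ) =
        fun y => fderiv ℝ φ y (EuclideanSpace.single l 1) := funext (partialDeriv_apply l φ)
    rw [this]
    have hd : DifferentiableAt ℝ (fderiv ℝ φ) x :=
      ((φ.smooth 2).fderiv_right (m := 1) (by norm_num)).differentiable (by norm_num) x
    rw [fderiv_clm_apply hd (differentiableAt_const _)]
    simp
  rw [h, h]
  have hs : IsSymmSndFDerivAt ℝ φ x :=
    (φ.smooth 2).contDiffAt.isSymmSndFDerivAt (by simp)
  rw [hs.eq]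

theorem fderiv_coordFun (j : Fin 2) (x v : Plane) : fderiv ℝ (coordFun j) x v = (v j : ℂ) := by
  have : coordFun j = Complex.ofRealCLM.comp (EuclideanSpace.proj (𝕜 := ℝ) j : Plane →L[ℝ] ℝ) := by
    funext y; simp [coordFun]
  rw [this, ContinuousLinearMap.fderiv]
  simp

/-- Leibniz rule for a partial derivative of `g φ`. -/
theorem partialDeriv_smulLeftCLM {g : Plane → ℂ} (hg : g.HasTemperateGrowth) (j : Fin 2)
    (φ : 𝓢(Plane, ℂ)) (x : Plane) :
    partialDeriv j (SchwartzMap.smulLeftCLM ℂ g φ) x =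
      fderiv ℝ g x (EuclideanSpace.single j 1) * φ x + g x * partialDeriv j φ x := by
  rw [partialDeriv_apply, partialDeriv_apply]
  have : (⇑(SchwartzMap.smulLeftCLM ℂ g φ) : Plane → ℂ) = fun y => g y * φ y := by
    funext y; rw [SchwartzMap.smulLeftCLM_apply_apply hg, smul_eq_mul]
  rw [this, fderiv_fun_mul (hg.1.differentiable (by simp) x) (φ.differentiableAt)]
  simp only [_root_.add_apply, _root_.smul_apply, smul_eq_mul]
  ring

theorem partialDeriv_mul_coordMul (i j : Fin 2) :
    partialDeriv i * coordMul j = coordMul j * partialDeriv i + if i = j then 1 else 0 := by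
  ext φ x
  have h : partialDeriv i (coordMul j φ) x = _ :=
    partialDeriv_smulLeftCLM (hasTemperateGrowth_coordFun j) i φ x
  rw [LinearMap.add_apply, Module.End.mul_apply, Module.End.mul_apply, _root_.add_apply, h,
    coordMul_apply, fderiv_coordFun]
  by_cases hij : i = j
  · subst hij; simp [coordFun, add_comm]
  · have hji : ¬ j = i := fun h => hij h.symm
    simp [coordFun, hij, hji]

/-- The components `πⱼ = -i∂ⱼ - Aⱼ` of the kinetic momentum, as operators on the Schwartz space. -/
def momentum (B : ℝ) : Fin 2 → Module.End ℂ 𝓢(Plane, ℂ) :=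
  ![-Complex.I • partialDeriv 0 + ((B / 2 : ℝ) : ℂ) • coordMul 1,
    -Complex.I • partialDeriv 1 - ((B / 2 : ℝ) : ℂ) • coordMul 0]

/-- The components `-i∂ⱼ + Aⱼ`, which generate the magnetic translations; they commute with the
kinetic momenta. -/
def dualMomentum (B : ℝ) : Fin 2 → Module.End ℂ 𝓢(Plane, ℂ) :=
  ![-Complex.I • partialDeriv 0 - ((B / 2 : ℝ) : ℂ) • coordMul 1,
    -Complex.I • partialDeriv 1 + ((B / 2 : ℝ) : ℂ) • coordMul 0]

theorem momentum_zero (B : ℝ) :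
    momentum B 0 = -Complex.I • partialDeriv 0 + ((B / 2 : ℝ) : ℂ) • coordMul 1 := rfl

theorem momentum_one (B : ℝ) :
    momentum B 1 = -Complex.I • partialDeriv 1 - ((B / 2 : ℝ) : ℂ) • coordMul 0 := rfl

theorem dualMomentum_zero (B : ℝ) :
    dualMomentum B 0 = -Complex.I • partialDeriv 0 - ((B / 2 : ℝ) : ℂ) • coordMul 1 := rfl

theorem dualMomentum_one (B : ℝ) :
    dualMomentum B 1 = -Complex.I • partialDeriv 1 + ((B / 2 : ℝ) : ℂ) • coordMul 0 := rfl

theorem momentum_zero_mul_momentum_one (B : ℝ) :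
    momentum B 0 * momentum B 1 =
      momentum B 1 * momentum B 0 + (Complex.I * B) • (1 : Module.End ℂ 𝓢(Plane, ℂ)) := by
  simp only [momentum_zero, momentum_one, add_mul, sub_mul, mul_add, mul_sub, smul_mul_assoc,
    mul_smul_comm, partialDeriv_mul_coordMul, if_true, partialDeriv_mul_partialDeriv 1 0,
    coordMul_mul_coordMul 1 0]
  push_cast
  module

theorem momentum_mul_dualMomentum (B : ℝ) (i j : Fin 2) :
    momentum B i * dualMomentum B j = dualMomentum B j * momentum B i := by
  fin_cases i <;> fin_cases j <;>
  simp only [Fin.zero_eta, Fin.mk_one, momentum_zero, momentum_one, dualMomentum_zero,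
    dualMomentum_one, add_mul, sub_mul, mul_add, mul_sub, smul_mul_assoc,
    mul_smul_comm, partialDeriv_mul_coordMul, if_true, partialDeriv_mul_partialDeriv 1 0,
    coordMul_mul_coordMul 1 0, zero_ne_one, one_ne_zero, if_false] <;> module

theorem momentum_apply (B : ℝ) (j : Fin 2) (φ : 𝓢(Plane, ℂ)) (x : Plane) :
    momentum B j φ x = magneticMomentum B j φ x := by
  fin_cases j
  · simp [momentum_zero, magneticMomentum, magneticPotential, partialDeriv_apply, coordMul_apply]
    ring
  · simp [momentum_one, magneticMomentum, magneticPotential, partialDeriv_apply, coordMul_apply]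
    ring

/-- The Landau Hamiltonian `π₀² + π₁²` on the Schwartz space. -/
def landauOp (B : ℝ) : Module.End ℂ 𝓢(Plane, ℂ) :=
  momentum B 0 * momentum B 0 + momentum B 1 * momentum B 1

theorem landauOp_eq_landauExpr (B : ℝ) (φ : 𝓢(Plane, ℂ)) :
    (⇑(landauOp B φ) : Plane → ℂ) = landauExpr B φ := by
  funext x
  have h : ∀ j, (⇑(momentum B j φ) : Plane → ℂ) = magneticMomentum B j φ :=
    fun j => funext (momentum_apply B j φ)
  simp only [landauOp, LinearMap.add_apply, Module.End.mul_apply, _root_.add_apply,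
    landauExpr, Fin.sum_univ_two, momentum_apply, h]

theorem landauOp_apply (B : ℝ) (φ : 𝓢(Plane, ℂ)) :
    landauOp B φ = momentum B 0 (momentum B 0 φ) + momentum B 1 (momentum B 1 φ) := rfl

/-- The lowering operator `π₀ + iπ₁`. -/
def lowering (B : ℝ) : Module.End ℂ 𝓢(Plane, ℂ) := momentum B 0 + Complex.I • momentum B 1

/-- The raising operator `π₀ - iπ₁`. -/
def raising (B : ℝ) : Module.End ℂ 𝓢(Plane, ℂ) := momentum B 0 - Complex.I • momentum B 1

theorem raising_mul_lowering (B : ℝ) :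
    raising B * lowering B = landauOp B - (B : ℂ) • (1 : Module.End ℂ 𝓢(Plane, ℂ)) := by
  have hI : (Complex.I * (Complex.I * B) : ℂ) = -B := by rw [← mul_assoc, Complex.I_mul_I]; ring
  rw [raising, lowering, landauOp]
  simp only [sub_mul, mul_add, mul_smul_comm, smul_mul_assoc, smul_sub, smul_add, smul_smul,
    momentum_zero_mul_momentum_one, hI, Complex.I_mul_I]
  module

theorem lowering_mul_raising (B : ℝ) :
    lowering B * raising B = landauOp B + (B : ℂ) • (1 : Module.End ℂ 𝓢(Plane, ℂ)) := by
  have hI : (Complex.I * (Complex.I * B) : ℂ) = -B := by rw [← mul_assoc, Complex.I_mul_I]; ring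
  rw [raising, lowering, landauOp]
  simp only [add_mul, mul_sub, mul_smul_comm, smul_mul_assoc, smul_add, smul_smul,
    momentum_zero_mul_momentum_one, hI, Complex.I_mul_I]
  module

theorem landauOp_mul_raising (B : ℝ) :
    landauOp B * raising B = raising B * landauOp B + (2 * B : ℂ) • raising B := by
  have h1 := raising_mul_lowering B
  have h2 := lowering_mul_raising B
  have h3 : landauOp B = raising B * lowering B + (B : ℂ) • 1 := by rw [h1]; module
  have h4 : landauOp B = lowering B * raising B - (B : ℂ) • 1 := by rw [h2]; module
  calc landauOp B * raising B
      = (raising B * lowering B + (B : ℂ) • 1) * raising B := by rw [← h3]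
    _ = raising B * (lowering B * raising B - (B : ℂ) • 1) + (2 * B : ℂ) • raising B := by
        simp only [add_mul, mul_sub, smul_mul_assoc, one_mul, mul_smul_comm, mul_one, mul_assoc]
        module
    _ = _ := by rw [← h4]

theorem landauOp_mul_lowering (B : ℝ) :
    landauOp B * lowering B = lowering B * landauOp B - (2 * B : ℂ) • lowering B := by
  have h1 := raising_mul_lowering B
  have h2 := lowering_mul_raising B
  have h3 : landauOp B = raising B * lowering B + (B : ℂ) • 1 := by rw [h1]; module
  have h4 : landauOp B = lowering B * raising B - (B : ℂ) • 1 := by rw [h2]; module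
  calc landauOp B * lowering B
      = (lowering B * raising B - (B : ℂ) • 1) * lowering B := by rw [← h4]
    _ = lowering B * (raising B * lowering B + (B : ℂ) • 1) - (2 * B : ℂ) • lowering B := by
        simp only [sub_mul, mul_add, smul_mul_assoc, one_mul, mul_smul_comm, mul_one, mul_assoc]
        module
    _ = _ := by rw [← h3]

theorem landauOp_mul_dualMomentum (B : ℝ) (j : Fin 2) :
    landauOp B * dualMomentum B j = dualMomentum B j * landauOp B := by
  simp only [landauOp, add_mul, mul_add, mul_assoc, momentum_mul_dualMomentum]
  simp only [← mul_assoc, momentum_mul_dualMomentum]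

theorem momentum_zero_eq (B : ℝ) :
    momentum B 0 = (1 / 2 : ℂ) • (lowering B + raising B) := by
  rw [lowering, raising]; module

theorem momentum_one_eq (B : ℝ) :
    momentum B 1 = (-Complex.I / 2) • (lowering B - raising B) := by
  have h : lowering B - raising B = (2 * Complex.I) • momentum B 1 := by
    rw [lowering, raising]; module
  rw [h, smul_smul]
  have : -Complex.I / 2 * (2 * Complex.I) = 1 := by
    linear_combination -Complex.I_mul_I
  rw [this, one_smul]

theorem smul_coordMul_one (B : ℝ) :
    (B : ℂ) • coordMul 1 = momentum B 0 - dualMomentum B 0 := by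
  rw [momentum_zero, dualMomentum_zero]; push_cast; module

theorem smul_coordMul_zero (B : ℝ) :
    (B : ℂ) • coordMul 0 = dualMomentum B 1 - momentum B 1 := by
  rw [momentum_one, dualMomentum_one]; push_cast; module

/-! ### The Schwartz space in `L²` and multiplication by weights -/

/-- The inclusion of the Schwartz space into `L²(ℝ²)`. -/
def toL2 : 𝓢(Plane, ℂ) →ₗ[ℂ] L2Plane := (SchwartzMap.toLpCLM ℂ ℂ 2 volume).toLinearMap

theorem toL2_coeFn (φ : 𝓢(Plane, ℂ)) : toL2 φ =ᵐ[volume] φ := φ.coeFn_toLp 2 volume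

theorem inner_toL2 (φ ψ : 𝓢(Plane, ℂ)) :
    inner ℂ (toL2 φ) (toL2 ψ) = ∫ x, conj (φ x) * ψ x := by
  have h := SchwartzMap.inner_toL2_toL2_eq φ ψ volume
  simp only [RCLike.inner_apply, mul_comm] at h
  exact h

theorem toL2_injective : Function.Injective toL2 :=
  SchwartzMap.injective_toLp 2 volume

theorem denseRange_toL2 : DenseRange toL2 :=
  SchwartzMap.denseRange_toLpCLM (F := ℂ) (p := 2) (μ := (volume : Measure Plane)) (by simp)

/-- Multiplication by a real weight `m` of temperate growth on the Schwartz space. -/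
def weightMul (m : Plane → ℝ) : Module.End ℂ 𝓢(Plane, ℂ) :=
  (SchwartzMap.smulLeftCLM ℂ (fun x => (m x : ℂ))).toLinearMap

theorem hasTemperateGrowth_ofReal {m : Plane → ℝ} (hm : m.HasTemperateGrowth) :
    Function.HasTemperateGrowth (fun x => (m x : ℂ)) :=
  Function.HasTemperateGrowth.comp (f := m) Function.Complex.hasTemperateGrowth_ofReal hm

theorem weightMul_apply {m : Plane → ℝ} (hm : m.HasTemperateGrowth) (φ : 𝓢(Plane, ℂ))
    (x : Plane) : weightMul m φ x = (m x : ℂ) * φ x := by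
  simp [weightMul, SchwartzMap.smulLeftCLM_apply_apply (hasTemperateGrowth_ofReal hm)]

theorem inner_weightMul_left {m : Plane → ℝ} (hm : m.HasTemperateGrowth) (φ ψ : 𝓢(Plane, ℂ)) :
    inner ℂ (toL2 (weightMul m φ)) (toL2 ψ) = inner ℂ (toL2 φ) (toL2 (weightMul m ψ)) := by
  rw [inner_toL2, inner_toL2]
  congr 1 with x
  rw [weightMul_apply hm, weightMul_apply hm, map_mul, Complex.conj_ofReal]
  ring

theorem inner_coordMul_left (j : Fin 2) (φ ψ : 𝓢(Plane, ℂ)) :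
    inner ℂ (toL2 (coordMul j φ)) (toL2 ψ) = inner ℂ (toL2 φ) (toL2 (coordMul j ψ)) :=
  inner_weightMul_left (hasTemperateGrowth_coord j) φ ψ

theorem inner_partialDeriv_left (j : Fin 2) (φ ψ : 𝓢(Plane, ℂ)) :
    inner ℂ (toL2 (partialDeriv j φ)) (toL2 ψ) = -inner ℂ (toL2 φ) (toL2 (partialDeriv j ψ)) := by
  rw [inner_toL2, inner_toL2]
  have h := SchwartzMap.integral_bilinear_lineDerivOp_right_eq_neg_left (μ := volume) φ ψ
    ((ContinuousLinearMap.mul ℝ ℂ).comp Complex.conjCLE.toContinuousLinearMap)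
    (EuclideanSpace.single j (1 : ℝ))
  simp only [ContinuousLinearMap.comp_apply, ContinuousLinearMap.mul_apply',
    ContinuousLinearEquiv.coe_coe, Complex.conjCLE_apply] at h
  have h' : ∀ χ : 𝓢(Plane, ℂ), partialDeriv j χ = ∂_{EuclideanSpace.single j (1 : ℝ)} χ :=
    fun χ => rfl
  rw [h', h', h, neg_neg]

theorem inner_momentum_left (B : ℝ) (j : Fin 2) (φ ψ : 𝓢(Plane, ℂ)) :
    inner ℂ (toL2 (momentum B j φ)) (toL2 ψ) = inner ℂ (toL2 φ) (toL2 (momentum B j ψ)) := by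
  fin_cases j
  · simp only [Fin.zero_eta, momentum_zero, LinearMap.add_apply, LinearMap.smul_apply, map_add,
      map_smul, inner_add_left, inner_add_right, inner_smul_left, inner_smul_right,
      inner_partialDeriv_left, inner_coordMul_left, map_neg, Complex.conj_I, Complex.conj_ofReal]
    ring
  · simp only [Fin.mk_one, momentum_one, LinearMap.sub_apply, LinearMap.smul_apply, map_sub,
      map_smul, inner_sub_left, inner_sub_right, inner_smul_left, inner_smul_right,
      inner_partialDeriv_left, inner_coordMul_left, map_neg, Complex.conj_I, Complex.conj_ofReal]
    ring

theorem inner_landauOp_left (B : ℝ) (φ ψ : 𝓢(Plane, ℂ)) :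
    inner ℂ (toL2 (landauOp B φ)) (toL2 ψ) = inner ℂ (toL2 φ) (toL2 (landauOp B ψ)) := by
  simp only [landauOp_apply, map_add, inner_add_left, inner_add_right, inner_momentum_left]

theorem inner_raising_right (B : ℝ) (φ ψ : 𝓢(Plane, ℂ)) :
    inner ℂ (toL2 φ) (toL2 (raising B ψ)) = inner ℂ (toL2 (lowering B φ)) (toL2 ψ) := by
  simp only [raising, lowering, LinearMap.add_apply, LinearMap.sub_apply, LinearMap.smul_apply,
    map_add, map_sub, map_smul, inner_add_left, inner_sub_right, inner_smul_left,
    inner_smul_right, inner_momentum_left, Complex.conj_I]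
  ring

theorem inner_landauOp_self (B : ℝ) (φ : 𝓢(Plane, ℂ)) :
    inner ℂ (toL2 φ) (toL2 (landauOp B φ)) =
      ((‖toL2 (momentum B 0 φ)‖ ^ 2 + ‖toL2 (momentum B 1 φ)‖ ^ 2 : ℝ) : ℂ) := by
  rw [landauOp_apply, map_add, inner_add_right, ← inner_momentum_left B 0 φ,
    ← inner_momentum_left B 1 φ, inner_self_eq_norm_sq_to_K, inner_self_eq_norm_sq_to_K]
  push_cast; rfl

/-- From `H₀ = (π₀ - iπ₁)(π₀ + iπ₁) + B`. -/
theorem inner_landauOp_self_eq_lowering (B : ℝ) (φ : 𝓢(Plane, ℂ)) :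
    inner ℂ (toL2 φ) (toL2 (landauOp B φ)) =
      ((‖toL2 (lowering B φ)‖ ^ 2 + B * ‖toL2 φ‖ ^ 2 : ℝ) : ℂ) := by
  have h : landauOp B φ = raising B (lowering B φ) + (B : ℂ) • φ := by
    have := LinearMap.congr_fun (raising_mul_lowering B) φ
    simp only [Module.End.mul_apply, LinearMap.sub_apply, LinearMap.smul_apply,
      Module.End.one_apply] at this
    rw [this]; module
  rw [h, map_add, inner_add_right, inner_raising_right, map_smul, inner_smul_right,
    inner_self_eq_norm_sq_to_K, inner_self_eq_norm_sq_to_K]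
  push_cast; rfl

theorem mul_norm_sq_le_re_inner_landauOp (B : ℝ) (φ : 𝓢(Plane, ℂ)) :
    B * ‖toL2 φ‖ ^ 2 ≤ (inner ℂ (toL2 φ) (toL2 (landauOp B φ))).re := by
  rw [inner_landauOp_self_eq_lowering, Complex.ofReal_re]
  have := sq_nonneg ‖toL2 (lowering B φ)‖
  linarith

/-! ### The Landau eigenspaces in the Schwartz space -/

/-- The Schwartz functions in the eigenspace of the Landau Hamiltonian at the level `λ_q`. -/
def landauEigenspace (B : ℝ) (q : ℕ) : Submodule ℂ 𝓢(Plane, ℂ) :=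
  Module.End.eigenspace (landauOp B) (landauLevel B q : ℂ)

/-- The finite sums of Schwartz eigenfunctions of the Landau Hamiltonian. -/
def landauSpan (B : ℝ) : Submodule ℂ 𝓢(Plane, ℂ) := ⨆ q, landauEigenspace B q

theorem mem_landauEigenspace {B : ℝ} {q : ℕ} {φ : 𝓢(Plane, ℂ)} :
    φ ∈ landauEigenspace B q ↔ landauOp B φ = (landauLevel B q : ℂ) • φ :=
  Module.End.mem_eigenspace_iff

theorem map_mem_landauSpan {B : ℝ} {T : Module.End ℂ 𝓢(Plane, ℂ)}
    (h : ∀ q, ∀ φ ∈ landauEigenspace B q, T φ ∈ landauSpan B) {φ : 𝓢(Plane, ℂ)}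
    (hφ : φ ∈ landauSpan B) : T φ ∈ landauSpan B := by
  have : landauSpan B ≤ (landauSpan B).comap T := iSup_le fun q φ hφ => h q φ hφ
  exact this hφ

theorem raising_mem_landauSpan {B : ℝ} {φ : 𝓢(Plane, ℂ)} (hφ : φ ∈ landauSpan B) :
    raising B φ ∈ landauSpan B := by
  refine map_mem_landauSpan (fun q φ hφ => ?_) hφ
  refine Submodule.mem_iSup_of_mem (q + 1) ?_
  rw [mem_landauEigenspace] at hφ ⊢
  have h := LinearMap.congr_fun (landauOp_mul_raising B) φ
  simp only [Module.End.mul_apply, LinearMap.add_apply, LinearMap.smul_apply, hφ, map_smul] at h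
  rw [h, landauLevel, landauLevel]
  push_cast; module

theorem lowering_mem_landauSpan {B : ℝ} {φ : 𝓢(Plane, ℂ)} (hφ : φ ∈ landauSpan B) :
    lowering B φ ∈ landauSpan B := by
  refine map_mem_landauSpan (fun q φ hφ => ?_) hφ
  rw [mem_landauEigenspace] at hφ
  cases q with
  | zero =>
    -- The ground state is annihilated, since `‖(π₀ + iπ₁)φ‖² = ⟨φ, (H₀ - B)φ⟩ = 0`.
    have h := inner_landauOp_self_eq_lowering B φ
    rw [hφ, map_smul, inner_smul_right, inner_self_eq_norm_sq_to_K, landauLevel] at h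
    have h2 : ((B * (2 * ((0 : ℕ) : ℝ) + 1)) * ‖toL2 φ‖ ^ 2 : ℝ) =
        ‖toL2 (lowering B φ)‖ ^ 2 + B * ‖toL2 φ‖ ^ 2 := by
      apply Complex.ofReal_injective
      rw [← h]; push_cast; rfl
    have h3 : ‖toL2 (lowering B φ)‖ ^ 2 = 0 := by
      rw [Nat.cast_zero] at h2; linarith
    have h4 : toL2 (lowering B φ) = 0 := norm_eq_zero.1 (pow_eq_zero_iff two_ne_zero |>.1 h3)
    have h5 : lowering B φ = 0 := toL2_injective (by rw [h4, map_zero])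
    rw [h5]
    exact Submodule.zero_mem _
  | succ q =>
    refine Submodule.mem_iSup_of_mem q ?_
    rw [mem_landauEigenspace]
    have h := LinearMap.congr_fun (landauOp_mul_lowering B) φ
    simp only [Module.End.mul_apply, LinearMap.sub_apply, LinearMap.smul_apply, hφ, map_smul] at h
    rw [h, landauLevel, landauLevel]
    push_cast; module

theorem momentum_mem_landauSpan {B : ℝ} (j : Fin 2) {φ : 𝓢(Plane, ℂ)} (hφ : φ ∈ landauSpan B) :
    momentum B j φ ∈ landauSpan B := by
  fin_cases j
  · simp only [Fin.zero_eta, momentum_zero_eq, LinearMap.smul_apply, LinearMap.add_apply]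
    exact Submodule.smul_mem _ _
      (Submodule.add_mem _ (lowering_mem_landauSpan hφ) (raising_mem_landauSpan hφ))
  · simp only [Fin.mk_one, momentum_one_eq, LinearMap.smul_apply, LinearMap.sub_apply]
    exact Submodule.smul_mem _ _
      (Submodule.sub_mem _ (lowering_mem_landauSpan hφ) (raising_mem_landauSpan hφ))

theorem dualMomentum_mem_landauSpan {B : ℝ} (j : Fin 2) {φ : 𝓢(Plane, ℂ)}
    (hφ : φ ∈ landauSpan B) : dualMomentum B j φ ∈ landauSpan B := by
  refine map_mem_landauSpan (fun q φ hφ => Submodule.mem_iSup_of_mem q ?_) hφ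
  rw [mem_landauEigenspace] at hφ ⊢
  have h := LinearMap.congr_fun (landauOp_mul_dualMomentum B j) φ
  simpa only [Module.End.mul_apply, hφ, map_smul] using h

/-- Since `B x₂ = π₁ - π̃₁` and `B x₁ = π̃₂ - π₂`. -/
theorem coordMul_mem_landauSpan {B : ℝ} (hB : B ≠ 0) (j : Fin 2) {φ : 𝓢(Plane, ℂ)}
    (hφ : φ ∈ landauSpan B) : coordMul j φ ∈ landauSpan B := by
  have hB' : (B : ℂ) ≠ 0 := Complex.ofReal_ne_zero.2 hB
  rw [← Submodule.smul_mem_iff _ hB']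
  fin_cases j
  · have := LinearMap.congr_fun (smul_coordMul_zero B) φ
    simp only [LinearMap.smul_apply, LinearMap.sub_apply] at this
    simp only [Fin.zero_eta, this]
    exact Submodule.sub_mem _ (dualMomentum_mem_landauSpan 1 hφ) (momentum_mem_landauSpan 1 hφ)
  · have := LinearMap.congr_fun (smul_coordMul_one B) φ
    simp only [LinearMap.smul_apply, LinearMap.sub_apply] at this
    simp only [Fin.mk_one, this]
    exact Submodule.sub_mem _ (momentum_mem_landauSpan 0 hφ) (dualMomentum_mem_landauSpan 0 hφ)

theorem landauLevel_pos {B : ℝ} (hB : 0 < B) (q : ℕ) : 0 < landauLevel B q := by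
  rw [landauLevel]; positivity

theorem exists_landauOp_eq {B : ℝ} (hB : 0 < B) {φ : 𝓢(Plane, ℂ)} (hφ : φ ∈ landauSpan B) :
    ∃ ψ ∈ landauSpan B, landauOp B ψ = φ := by
  have : landauSpan B ≤ (landauSpan B).map (landauOp B) := by
    refine iSup_le fun q φ hφ => ?_
    have hq : (landauLevel B q : ℂ) ≠ 0 := Complex.ofReal_ne_zero.2 (landauLevel_pos hB q).ne'
    refine ⟨(landauLevel B q : ℂ)⁻¹ • φ,
      Submodule.smul_mem _ _ (Submodule.mem_iSup_of_mem q hφ), ?_⟩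
    rw [mem_landauEigenspace] at hφ
    rw [map_smul, hφ, smul_smul, inv_mul_cancel₀ hq, one_smul]
  exact this hφ

/-! ### The Gaussian ground state -/

theorem one_add_pow_mul_exp_neg_sq_le (m : ℕ) {b r : ℝ} (hb : 0 < b) (hr : 0 ≤ r) :
    (1 + r) ^ m * Real.exp (-(b * r ^ 2)) ≤ m.factorial * Real.exp (1 + 1 / (4 * b)) := by
  have h1 : (1 + r) ^ m ≤ m.factorial * Real.exp (1 + r) := by
    have := Real.pow_div_factorial_le_exp (1 + r) (by positivity) m
    rw [div_le_iff₀ (by positivity)] at this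
    linarith
  have h2 : 1 + r + -(b * r ^ 2) ≤ 1 + 1 / (4 * b) := by
    have : 1 / (4 * b) - r + b * r ^ 2 = (2 * b * r - 1) ^ 2 / (4 * b) := by
      field_simp; ring
    have h3 : 0 ≤ (2 * b * r - 1) ^ 2 / (4 * b) := by positivity
    linarith
  calc (1 + r) ^ m * Real.exp (-(b * r ^ 2))
      ≤ m.factorial * Real.exp (1 + r) * Real.exp (-(b * r ^ 2)) := by gcongr
    _ = m.factorial * Real.exp (1 + r + -(b * r ^ 2)) := by rw [mul_assoc, ← Real.exp_add]
    _ ≤ _ := by gcongr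

theorem iteratedFDeriv_exp_neg_mul_sq_decay {b : ℝ} (hb : 0 < b) (k n : ℕ) :
    ∃ C : ℝ, ∀ x : Plane,
      ‖x‖ ^ k * ‖iteratedFDeriv ℝ n (fun y : Plane => Real.exp (-(b * ‖y‖ ^ 2))) x‖ ≤ C := by
  have hq : Function.HasTemperateGrowth (fun y : Plane => -(b * ‖y‖ ^ 2)) :=
    ((Function.HasTemperateGrowth.const b).mul (Function.hasTemperateGrowth_norm_sq Plane)).neg
  obtain ⟨l, A, hA, hAb⟩ := hq.norm_iteratedFDeriv_le_uniform n
  refine ⟨n.factorial * (A + 1) ^ n * ((k + l * n).factorial * Real.exp (1 + 1 / (4 * b))),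
    fun x => ?_⟩
  have hx : (1 : ℝ) ≤ 1 + ‖x‖ := by linarith [norm_nonneg x]
  have hD1 : 1 ≤ (A + 1) * (1 + ‖x‖) ^ l := by
    have := one_le_pow₀ hx (n := l)
    nlinarith
  have hder : ‖iteratedFDeriv ℝ n (Real.exp ∘ fun y : Plane => -(b * ‖y‖ ^ 2)) x‖ ≤
      n.factorial * Real.exp (-(b * ‖x‖ ^ 2)) * ((A + 1) * (1 + ‖x‖) ^ l) ^ n := by
    refine norm_iteratedFDeriv_comp_le (N := ∞) Real.contDiff_exp hq.1 (by exact_mod_cast le_top) x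
      (fun i _ => ?_) (fun i hi hin => ?_)
    · rw [norm_iteratedFDeriv_eq_norm_iteratedDeriv, iteratedDeriv_eq_iterate,
        Real.iter_deriv_exp, Real.norm_eq_abs, Real.abs_exp]
    · refine (hAb i hin x).trans ?_
      refine le_trans ?_ (le_self_pow₀ hD1 (by omega))
      gcongr
      linarith
  have hcomp : (fun y : Plane => Real.exp (-(b * ‖y‖ ^ 2))) =
      Real.exp ∘ fun y : Plane => -(b * ‖y‖ ^ 2) := rfl
  rw [hcomp]
  calc ‖x‖ ^ k * _ ≤ (1 + ‖x‖) ^ k *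
        (n.factorial * Real.exp (-(b * ‖x‖ ^ 2)) * ((A + 1) * (1 + ‖x‖) ^ l) ^ n) := by
        gcongr; linarith
    _ = n.factorial * (A + 1) ^ n * ((1 + ‖x‖) ^ (k + l * n) * Real.exp (-(b * ‖x‖ ^ 2))) := by
        rw [mul_pow, ← pow_mul, pow_add]; ring
    _ ≤ _ := by
        refine mul_le_mul_of_nonneg_left ?_ (by positivity)
        exact one_add_pow_mul_exp_neg_sq_le _ hb (norm_nonneg x)

/-- The Gaussian `exp(-B|x|²/4)` as a real Schwartz function. -/
def realGaussian {B : ℝ} (hB : 0 < B) : 𝓢(Plane, ℝ) where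
  toFun x := Real.exp (-(B / 4 * ‖x‖ ^ 2))
  smooth' := Real.contDiff_exp.comp
    ((Function.HasTemperateGrowth.const (B / 4)).mul
      (Function.hasTemperateGrowth_norm_sq Plane)).neg.1
  decay' k n := iteratedFDeriv_exp_neg_mul_sq_decay (by positivity) k n

/-- The Gaussian `exp(-B|x|²/4)`, a ground state of the Landau Hamiltonian. -/
def gaussian {B : ℝ} (hB : 0 < B) : 𝓢(Plane, ℂ) :=
  SchwartzMap.postcompCLM Complex.ofRealCLM (realGaussian hB)

theorem gaussian_apply {B : ℝ} (hB : 0 < B) (x : Plane) :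
    gaussian hB x = (Real.exp (-(B / 4 * ‖x‖ ^ 2)) : ℂ) := by
  rw [gaussian, SchwartzMap.postcompCLM_apply]
  rfl

theorem partialDeriv_gaussian {B : ℝ} (hB : 0 < B) (j : Fin 2) :
    partialDeriv j (gaussian hB) = (-(B / 2) : ℂ) • coordMul j (gaussian hB) := by
  ext x
  have h1 : HasFDerivAt (fun y : Plane => Real.exp (-(B / 4 * ‖y‖ ^ 2)))
      (Real.exp (-(B / 4 * ‖x‖ ^ 2)) • -((B / 4) • ((2 : ℕ) • (innerSL ℝ x : Plane →L[ℝ] ℝ)))) x :=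
    (((hasStrictFDerivAt_norm_sq x).hasFDerivAt.const_mul (B / 4)).neg).exp
  have h2 := Complex.ofRealCLM.hasFDerivAt.comp x h1
  have h3 : (⇑(gaussian hB) : Plane → ℂ) =
      Complex.ofRealCLM ∘ fun y : Plane => Real.exp (-(B / 4 * ‖y‖ ^ 2)) :=
    funext fun y => gaussian_apply hB y
  rw [partialDeriv_apply, _root_.smul_apply, coordMul_apply, h3, h2.fderiv]
  simp [EuclideanSpace.inner_single_right]
  ring

theorem lowering_gaussian {B : ℝ} (hB : 0 < B) : lowering B (gaussian hB) = 0 := by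
  simp only [lowering, momentum_zero, momentum_one, LinearMap.add_apply, LinearMap.sub_apply,
    LinearMap.smul_apply, partialDeriv_gaussian, smul_sub, smul_smul]
  push_cast
  have hI := Complex.I_mul_I
  match_scalars
  · ring
  · linear_combination ((B : ℂ) / 2) * hI

theorem gaussian_mem_landauSpan {B : ℝ} (hB : 0 < B) : gaussian hB ∈ landauSpan B := by
  refine Submodule.mem_iSup_of_mem 0 ?_
  rw [mem_landauEigenspace]
  have := LinearMap.congr_fun (raising_mul_lowering B) (gaussian hB)
  simp only [Module.End.mul_apply, lowering_gaussian, map_zero, LinearMap.sub_apply,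
    LinearMap.smul_apply, Module.End.one_apply] at this
  rw [landauLevel, ← sub_eq_zero, this]
  push_cast; module

/-! ### Completeness of the Landau eigenfunctions -/

/-- The Fourier transform is injective on `L¹`. -/
theorem ae_eq_zero_of_fourier_eq_zero {V : Type*} [NormedAddCommGroup V] [InnerProductSpace ℝ V]
    [FiniteDimensional ℝ V] [MeasurableSpace V] [BorelSpace V] {f : V → ℂ} (hf : Integrable f)
    (h : ∀ w, 𝓕 f w = 0) : ∀ᵐ x, f x = 0 := by
  refine ae_eq_zero_of_integral_contDiff_smul_eq_zero hf.locallyIntegrable fun g hg hgs => ?_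
  have hs : HasCompactSupport (fun x => (g x : ℂ)) := hgs.comp_left (g := Complex.ofReal) rfl
  have hd : ContDiff ℝ ∞ (fun x => (g x : ℂ)) := Complex.ofRealCLM.contDiff.comp hg
  set ψ : 𝓢(V, ℂ) := hs.toSchwartzMap hd
  have key := VectorFourier.integral_fourierIntegral_smul_eq_flip (L := innerₗ V) (μ := volume)
    (ν := volume) (f := f) (g := (𝓕⁻ ψ : 𝓢(V, ℂ))) Real.continuous_fourierChar continuous_inner hf
    (𝓕⁻ ψ : 𝓢(V, ℂ)).integrable
  have h1 : ∀ ξ, VectorFourier.fourierIntegral Real.fourierChar volume (innerₗ V) f ξ = 0 := h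
  have h2 : ∀ x, VectorFourier.fourierIntegral Real.fourierChar volume (innerₗ V).flip
      (𝓕⁻ ψ : 𝓢(V, ℂ)) x = g x := by
    intro x
    have h3 : 𝓕 (𝓕⁻ ψ) = ψ := FourierTransform.fourier_fourierInv_eq ψ
    have h4 : 𝓕 (⇑(𝓕⁻ ψ : 𝓢(V, ℂ)) : V → ℂ) x = ψ x := by
      rw [← SchwartzMap.fourier_coe, h3]
    rw [flip_innerₗ]
    exact h4
  simp only [h1, h2, zero_smul, integral_zero] at key
  rw [key]
  congr 1 with x
  rw [smul_eq_mul, Complex.real_smul, mul_comm]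

/-- Multiplication by the linear function `x ↦ ⟪ξ, x⟫`. -/
def linearMul (ξ : Plane) : Module.End ℂ 𝓢(Plane, ℂ) :=
  (ξ 0 : ℂ) • coordMul 0 + (ξ 1 : ℂ) • coordMul 1

theorem linearMul_apply (ξ : Plane) (φ : 𝓢(Plane, ℂ)) (x : Plane) :
    linearMul ξ φ x = ((inner ℝ ξ x : ℝ) : ℂ) * φ x := by
  simp only [linearMul, LinearMap.add_apply, LinearMap.smul_apply, _root_.add_apply,
    _root_.smul_apply, coordMul_apply, smul_eq_mul, PiLp.inner_apply, Fin.sum_univ_two,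
    RCLike.inner_apply, conj_trivial]
  push_cast
  ring

theorem linearMul_pow_apply (ξ : Plane) (n : ℕ) (φ : 𝓢(Plane, ℂ)) (x : Plane) :
    (linearMul ξ ^ n) φ x = ((inner ℝ ξ x : ℝ) : ℂ) ^ n * φ x := by
  induction n with
  | zero => simp
  | succ n ih => rw [pow_succ', Module.End.mul_apply, linearMul_apply, ih]; ring

theorem linearMul_pow_mem_landauSpan {B : ℝ} (hB : B ≠ 0) (ξ : Plane) (n : ℕ) {φ : 𝓢(Plane, ℂ)}
    (hφ : φ ∈ landauSpan B) : (linearMul ξ ^ n) φ ∈ landauSpan B := by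
  induction n with
  | zero => simpa using hφ
  | succ n ih =>
    rw [pow_succ', Module.End.mul_apply, linearMul, LinearMap.add_apply, LinearMap.smul_apply,
      LinearMap.smul_apply]
    exact Submodule.add_mem _ (Submodule.smul_mem _ _ (coordMul_mem_landauSpan hB 0 ih))
      (Submodule.smul_mem _ _ (coordMul_mem_landauSpan hB 1 ih))

theorem integrable_schwartz_mul (φ : 𝓢(Plane, ℂ)) (g : L2Plane) :
    Integrable (fun x => φ x * g x) :=
  (φ.memLp 2 volume).integrable_mul (Lp.memLp g)

/-- An exponential is absorbed by passing from `exp(-B|x|²/4)` to a wider Gaussian. -/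
theorem exp_mul_gaussian_le {B : ℝ} (hB : 0 < B) (ξ x : Plane) :
    Real.exp |inner ℝ ξ x| * ‖gaussian hB x‖ ≤
      Real.exp (2 * ‖ξ‖ ^ 2 / B) * ‖gaussian (half_pos hB) x‖ := by
  simp only [gaussian_apply, Complex.norm_real, Real.norm_eq_abs, Real.abs_exp]
  rw [← Real.exp_add, ← Real.exp_add, Real.exp_le_exp]
  have h1 : |inner ℝ ξ x| ≤ ‖ξ‖ * ‖x‖ := abs_real_inner_le_norm ξ x
  have h2 : 2 * ‖ξ‖ ^ 2 / B - ‖ξ‖ * ‖x‖ + B / 8 * ‖x‖ ^ 2 =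
      (B * ‖x‖ - 4 * ‖ξ‖) ^ 2 / (8 * B) := by
    field_simp; ring
  have h3 : 0 ≤ (B * ‖x‖ - 4 * ‖ξ‖) ^ 2 / (8 * B) := by positivity
  linarith

/-- A function in `L²` orthogonal to all `⟪ξ, x⟫ⁿ exp(-B|x|²/4)` vanishes: the Fourier transform of
its product with the Gaussian is the sum of a power series with vanishing terms. -/
theorem eq_zero_of_inner_landauSpan_eq_zero {B : ℝ} (hB : 0 < B) {g : L2Plane}
    (hg : ∀ φ ∈ landauSpan B, inner ℂ (toL2 φ) g = 0) : g = 0 := by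
  have hconj : ∀ x, conj (gaussian hB x) = gaussian hB x := fun x => by
    rw [gaussian_apply, Complex.conj_ofReal]
  have hterm : ∀ (ξ : Plane) (n : ℕ),
      ∫ x, ((inner ℝ ξ x : ℝ) : ℂ) ^ n * (gaussian hB x * g x) = 0 := by
    intro ξ n
    have h := hg _ (linearMul_pow_mem_landauSpan hB.ne' ξ n (gaussian_mem_landauSpan hB))
    rw [L2.inner_def] at h
    rw [← h]
    refine integral_congr_ae ?_
    filter_upwards [toL2_coeFn ((linearMul ξ ^ n) (gaussian hB))] with x hx
    rw [hx, linearMul_pow_apply, RCLike.inner_apply, map_mul, map_pow, Complex.conj_ofReal, hconj]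
    ring
  have hint : Integrable (fun x => gaussian hB x * g x) := integrable_schwartz_mul _ g
  have hzero : ∀ᵐ x, gaussian hB x * g x = 0 := by
    refine ae_eq_zero_of_fourier_eq_zero hint fun w => ?_
    set ξ : Plane := (-2 * Real.pi) • w with hξ
    have hF : ∀ x : Plane, Complex.exp (((-2 * Real.pi * inner ℝ x w : ℝ) : ℂ) * Complex.I) =
        Complex.exp (((inner ℝ ξ x : ℝ) : ℂ) * Complex.I) := by
      intro x; rw [hξ, real_inner_smul_left, real_inner_comm]
    rw [Real.fourier_eq']
    simp only [hF, smul_eq_mul]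
    have hsum : HasSum
        (fun n : ℕ => ∫ x, (((inner ℝ ξ x : ℝ) : ℂ) * Complex.I) ^ n / (n.factorial : ℂ) *
          (gaussian hB x * g x))
        (∫ x, Complex.exp (((inner ℝ ξ x : ℝ) : ℂ) * Complex.I) * (gaussian hB x * g x)) := by
      refine hasSum_integral_of_dominated_convergence
        (fun n x => |inner ℝ ξ x| ^ n / n.factorial * ‖gaussian hB x * g x‖)
        (fun n => ?_) (fun n => ?_) ?_ ?_ ?_
      · have hc : Continuous fun x : Plane =>
            (((inner ℝ ξ x : ℝ) : ℂ) * Complex.I) ^ n / (n.factorial : ℂ) := by fun_prop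
        exact hc.aestronglyMeasurable.mul hint.aestronglyMeasurable
      · refine Filter.Eventually.of_forall fun x => le_of_eq ?_
        rw [norm_mul, norm_div, norm_pow, norm_mul, Complex.norm_I, mul_one, Complex.norm_real,
          Real.norm_eq_abs, Complex.norm_natCast]
      · exact Filter.Eventually.of_forall fun x =>
          (Real.summable_pow_div_factorial _).mul_right _
      · have htsum : ∀ x : Plane, (∑' n : ℕ, |inner ℝ ξ x| ^ n / n.factorial *
            ‖gaussian hB x * g x‖) = Real.exp |inner ℝ ξ x| * ‖gaussian hB x * g x‖ := by
          intro x
          rw [tsum_mul_right, Real.exp_eq_exp_ℝ, NormedSpace.exp_eq_tsum_div]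
        simp only [htsum]
        refine Integrable.mono' (((integrable_schwartz_mul (gaussian (half_pos hB)) g).norm).const_mul
          (Real.exp (2 * ‖ξ‖ ^ 2 / B))) ?_ (Filter.Eventually.of_forall fun x => ?_)
        · have hc : Continuous fun x : Plane => Real.exp |inner ℝ ξ x| := by fun_prop
          exact hc.aestronglyMeasurable.mul hint.aestronglyMeasurable.norm
        · rw [Real.norm_eq_abs, abs_of_nonneg (by positivity), norm_mul, norm_mul, ← mul_assoc,
            ← mul_assoc]
          exact mul_le_mul_of_nonneg_right (exp_mul_gaussian_le hB ξ x) (norm_nonneg _)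
      · refine Filter.Eventually.of_forall fun x => ?_
        refine HasSum.mul_right _ ?_
        rw [Complex.exp_eq_exp_ℂ]
        exact NormedSpace.expSeries_div_hasSum_exp _
    have hzero : ∀ n : ℕ, ∫ x, (((inner ℝ ξ x : ℝ) : ℂ) * Complex.I) ^ n / (n.factorial : ℂ) *
        (gaussian hB x * g x) = 0 := by
      intro n
      have : ∀ x : Plane, (((inner ℝ ξ x : ℝ) : ℂ) * Complex.I) ^ n / (n.factorial : ℂ) *
          (gaussian hB x * g x) = (Complex.I ^ n / (n.factorial : ℂ)) *
            (((inner ℝ ξ x : ℝ) : ℂ) ^ n * (gaussian hB x * g x)) := fun x => by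
        rw [mul_pow]; ring
      simp only [this, integral_const_mul, hterm, mul_zero]
    simp only [hzero] at hsum
    exact hsum.unique hasSum_zero
  rw [Lp.eq_zero_iff_ae_eq_zero]
  filter_upwards [hzero] with x hx
  have hne : gaussian hB x ≠ 0 := by
    rw [gaussian_apply]; exact Complex.ofReal_ne_zero.2 (Real.exp_pos _).ne'
  exact (mul_eq_zero.1 hx).resolve_left hne

theorem dense_map_landauSpan {B : ℝ} (hB : 0 < B) :
    Dense ((landauSpan B).map toL2 : Set L2Plane) := by
  rw [Submodule.dense_iff_topologicalClosure_eq_top, Submodule.topologicalClosure_eq_top_iff,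
    Submodule.eq_bot_iff]
  intro g hg
  refine eq_zero_of_inner_landauSpan_eq_zero hB fun φ hφ => ?_
  exact (Submodule.mem_orthogonal _ _).1 hg _ (Submodule.mem_map_of_mem hφ)

/-! ### Weighted masses and the virial identity -/

/-- The mass `∫ m |φ|²` of a Schwartz function against a weight `m`. -/
def weightedMass (m : Plane → ℝ) (φ : 𝓢(Plane, ℂ)) : ℝ := ∫ x, m x * ‖φ x‖ ^ 2

theorem integrable_norm_sq (φ : 𝓢(Plane, ℂ)) : Integrable (fun x => ‖φ x‖ ^ 2) :=
  (memLp_two_iff_integrable_sq_norm φ.continuous.aestronglyMeasurable).1 (φ.memLp 2 volume)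

theorem integral_norm_sq (φ : 𝓢(Plane, ℂ)) : ∫ x, ‖φ x‖ ^ 2 = ‖toL2 φ‖ ^ 2 := by
  have h1 := inner_self_eq_norm_sq_to_K (𝕜 := ℂ) (toL2 φ)
  rw [inner_toL2] at h1
  have h2 : ∀ x, conj (φ x) * φ x = ((‖φ x‖ ^ 2 : ℝ) : ℂ) := fun x => by
    rw [mul_comm, Complex.mul_conj, Complex.normSq_eq_norm_sq]
  simp only [h2, integral_complex_ofReal] at h1
  apply Complex.ofReal_injective
  rw [h1]; push_cast; rfl

theorem integrable_weight_mul_norm_sq {m : Plane → ℝ} (hm : Continuous m) {C : ℝ}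
    (hC : ∀ x, |m x| ≤ C) (φ : 𝓢(Plane, ℂ)) : Integrable (fun x => m x * ‖φ x‖ ^ 2) :=
  (integrable_norm_sq φ).bdd_mul hm.aestronglyMeasurable
    (Filter.Eventually.of_forall hC)

theorem weightedMass_mono {m₁ m₂ : Plane → ℝ} (h₁ : Continuous m₁) (h₂ : Continuous m₂)
    {C₁ C₂ : ℝ} (hC₁ : ∀ x, |m₁ x| ≤ C₁) (hC₂ : ∀ x, |m₂ x| ≤ C₂) (h : ∀ x, m₁ x ≤ m₂ x)
    (φ : 𝓢(Plane, ℂ)) : weightedMass m₁ φ ≤ weightedMass m₂ φ :=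
  integral_mono (integrable_weight_mul_norm_sq h₁ hC₁ φ) (integrable_weight_mul_norm_sq h₂ hC₂ φ)
    fun x => mul_le_mul_of_nonneg_right (h x) (sq_nonneg _)

theorem re_inner_weightMul_self {m : Plane → ℝ} (hm : m.HasTemperateGrowth) (φ : 𝓢(Plane, ℂ)) :
    (inner ℂ (toL2 (weightMul m φ)) (toL2 φ)).re = weightedMass m φ := by
  rw [inner_toL2]
  have h2 : ∀ x, conj (weightMul m φ x) * φ x = ((m x * ‖φ x‖ ^ 2 : ℝ) : ℂ) := fun x => by
    rw [weightMul_apply hm, map_mul, Complex.conj_ofReal, mul_assoc, mul_comm (conj _),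
      Complex.mul_conj, Complex.normSq_eq_norm_sq]
    push_cast; rfl
  simp only [h2, integral_complex_ofReal, Complex.ofReal_re]
  rfl

theorem norm_weightMul_le {m : Plane → ℝ} (hm : m.HasTemperateGrowth) {C : ℝ}
    (hC : ∀ x, |m x| ≤ C) (φ : 𝓢(Plane, ℂ)) : ‖toL2 (weightMul m φ)‖ ≤ C * ‖toL2 φ‖ := by
  refine Lp.norm_le_mul_norm_of_ae_le_mul ?_
  filter_upwards [toL2_coeFn φ, toL2_coeFn (weightMul m φ)] with x h1 h2
  rw [h1, h2, weightMul_apply hm, norm_mul, Complex.norm_real, Real.norm_eq_abs]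
  exact mul_le_mul_of_nonneg_right (hC x) (norm_nonneg _)

/-- The commutation relation `[πⱼ, m] = -i ∂ⱼm`. -/
theorem momentum_weightMul (B : ℝ) (j : Fin 2) {m m' : Plane → ℝ} (hm : m.HasTemperateGrowth)
    (hm' : m'.HasTemperateGrowth)
    (hd : ∀ x, fderiv ℝ m x (EuclideanSpace.single j 1) = m' x) (φ : 𝓢(Plane, ℂ)) :
    momentum B j (weightMul m φ) =
      weightMul m (momentum B j φ) - Complex.I • weightMul m' φ := by
  have hdc : ∀ x, fderiv ℝ (fun y => (m y : ℂ)) x (EuclideanSpace.single j 1) = m' x := by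
    intro x
    have h := Complex.ofRealCLM.hasFDerivAt.comp x
      ((hm.1.differentiable (by simp)) x).hasFDerivAt
    have h' : (fun y => (m y : ℂ)) = Complex.ofRealCLM ∘ m := rfl
    rw [h', h.fderiv]
    simp [hd]
  ext x
  have hpd : partialDeriv j (weightMul m φ) x = (m' x : ℂ) * φ x + m x * partialDeriv j φ x := by
    rw [← hdc x]
    exact partialDeriv_smulLeftCLM (hasTemperateGrowth_ofReal hm) j φ x
  fin_cases j
  · simp only [Fin.zero_eta, Fin.isValue, momentum_zero, LinearMap.add_apply,
      LinearMap.smul_apply, _root_.add_apply, _root_.smul_apply, _root_.sub_apply, smul_eq_mul,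
      weightMul_apply hm, weightMul_apply hm', coordMul_apply] at hpd ⊢
    rw [hpd]; ring
  · simp only [Fin.mk_one, Fin.isValue, momentum_one, LinearMap.sub_apply,
      LinearMap.smul_apply, _root_.smul_apply, _root_.sub_apply, smul_eq_mul,
      weightMul_apply hm, weightMul_apply hm', coordMul_apply] at hpd ⊢
    rw [hpd]; ring

theorem weightMul_zero : weightMul (fun _ => 0) = 0 := by
  ext φ x
  rw [weightMul_apply (Function.HasTemperateGrowth.const 0)]
  simp

theorem im_inner_weightMul_momentum (B : ℝ) (j : Fin 2) {m m' : Plane → ℝ}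
    (hm : m.HasTemperateGrowth) (hm' : m'.HasTemperateGrowth)
    (hd : ∀ x, fderiv ℝ m x (EuclideanSpace.single j 1) = m' x) (φ : 𝓢(Plane, ℂ)) :
    2 * (inner ℂ (toL2 (weightMul m φ)) (toL2 (momentum B j φ))).im = weightedMass m' φ := by
  have h1 : inner ℂ (toL2 (weightMul m φ)) (toL2 (momentum B j φ)) =
      conj (inner ℂ (toL2 (weightMul m φ)) (toL2 (momentum B j φ))) +
        Complex.I * inner ℂ (toL2 (weightMul m' φ)) (toL2 φ) := by
    rw [inner_conj_symm, ← inner_weightMul_left hm, ← inner_momentum_left,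
      momentum_weightMul B j hm hm' hd, map_sub, inner_sub_left, map_smul, inner_smul_left,
      Complex.conj_I]
    ring
  have h2 := congrArg Complex.im h1
  rw [← re_inner_weightMul_self hm']
  simp only [Complex.add_im, Complex.conj_im, Complex.mul_im, Complex.I_re, Complex.I_im] at h2
  linarith

/-- The virial identity: the expectation of the commutator of `H₀` with `γπⱼ + πⱼγ`, for a weight
`γ` depending on `xⱼ` only. The number `β` is `±B`, according to the sign of `[πⱼ, πₖ] = iβ`. -/
theorem virial_identity (B : ℝ) {j k : Fin 2} {β : ℝ} {γ η : Plane → ℝ}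
    (hH : ∀ φ, landauOp B φ =
      momentum B j (momentum B j φ) + momentum B k (momentum B k φ))
    (hcomm : ∀ φ, momentum B k (momentum B j φ) =
      momentum B j (momentum B k φ) - (Complex.I * β) • φ)
    (hγ : γ.HasTemperateGrowth) (hη : η.HasTemperateGrowth)
    (hj : ∀ x, fderiv ℝ γ x (EuclideanSpace.single j 1) = η x)
    (hk : ∀ x, fderiv ℝ γ x (EuclideanSpace.single k 1) = 0) (z : ℝ) (φ : 𝓢(Plane, ℂ)) :
    weightedMass η (momentum B j φ) - weightedMass η (momentum B k φ) + z * weightedMass η φ =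
      2 * (inner ℂ (toL2 (weightMul γ (momentum B j φ)))
          (toL2 (landauOp B φ - (z : ℂ) • φ))).im
        - 2 * β * (inner ℂ (toL2 (weightMul γ φ)) (toL2 (momentum B k φ))).re := by
  have h0 := Function.HasTemperateGrowth.const (E := Plane) (0 : ℝ)
  have hX := im_inner_weightMul_momentum B j hγ hη hj (momentum B j φ)
  have hY' := im_inner_weightMul_momentum B j hγ hη hj (momentum B k φ)
  have hZ' := im_inner_weightMul_momentum B j hγ hη hj φ
  have hswap : ∀ ψ : 𝓢(Plane, ℂ), (inner ℂ (toL2 (weightMul γ (momentum B j ψ))) (toL2 ψ)).im =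
      -(inner ℂ (toL2 (weightMul γ ψ)) (toL2 (momentum B j ψ))).im := by
    intro ψ
    rw [inner_weightMul_left hγ, ← inner_conj_symm, Complex.conj_im]
  have hY : inner ℂ (toL2 (weightMul γ (momentum B j φ)))
        (toL2 (momentum B k (momentum B k φ))) =
      inner ℂ (toL2 (weightMul γ (momentum B j (momentum B k φ)))) (toL2 (momentum B k φ)) +
        Complex.I * β * inner ℂ (toL2 (weightMul γ φ)) (toL2 (momentum B k φ)) := by
    rw [← inner_momentum_left, momentum_weightMul B k hγ h0 hk, weightMul_zero, hcomm]
    simp only [LinearMap.zero_apply, smul_zero, sub_zero, map_sub, map_smul, inner_sub_left,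
      inner_smul_left, map_mul, Complex.conj_I, Complex.conj_ofReal]
    ring
  rw [hH, map_sub, map_add, map_smul, inner_sub_right, inner_add_right, inner_smul_right, hY]
  simp only [Complex.sub_im, Complex.add_im, Complex.re_ofReal_mul, Complex.im_ofReal_mul, hswap,
    mul_assoc, Complex.I_mul_im]
  linear_combination -hX + hY' - z * hZ'

/-- Integration by parts in `⟨mφ, H₀φ⟩`. -/
theorem abs_weighted_energy_sub_le (B : ℝ) {m m₀ m₁ : Plane → ℝ} (hm : m.HasTemperateGrowth)
    (hm₀ : m₀.HasTemperateGrowth) (hm₁ : m₁.HasTemperateGrowth)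
    (hd₀ : ∀ x, fderiv ℝ m x (EuclideanSpace.single 0 1) = m₀ x)
    (hd₁ : ∀ x, fderiv ℝ m x (EuclideanSpace.single 1 1) = m₁ x) {a₀ a₁ : ℝ}
    (ha₀ : ∀ x, |m₀ x| ≤ a₀) (ha₁ : ∀ x, |m₁ x| ≤ a₁) (φ : 𝓢(Plane, ℂ)) :
    |weightedMass m (momentum B 0 φ) + weightedMass m (momentum B 1 φ) -
        (inner ℂ (toL2 (weightMul m φ)) (toL2 (landauOp B φ))).re| ≤
      a₀ * ‖toL2 φ‖ * ‖toL2 (momentum B 0 φ)‖ + a₁ * ‖toL2 φ‖ * ‖toL2 (momentum B 1 φ)‖ := by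
  have key : ∀ (j : Fin 2) (m' : Plane → ℝ), m'.HasTemperateGrowth →
      (∀ x, fderiv ℝ m x (EuclideanSpace.single j 1) = m' x) → ∀ a : ℝ, (∀ x, |m' x| ≤ a) →
      |weightedMass m (momentum B j φ) -
        (inner ℂ (toL2 (weightMul m φ)) (toL2 (momentum B j (momentum B j φ)))).re| ≤
      a * ‖toL2 φ‖ * ‖toL2 (momentum B j φ)‖ := by
    intro j m' hm' hd a ha
    have h1 : inner ℂ (toL2 (weightMul m φ)) (toL2 (momentum B j (momentum B j φ))) =
        inner ℂ (toL2 (weightMul m (momentum B j φ))) (toL2 (momentum B j φ)) +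
          Complex.I * inner ℂ (toL2 (weightMul m' φ)) (toL2 (momentum B j φ)) := by
      rw [← inner_momentum_left, momentum_weightMul B j hm hm' hd, map_sub, inner_sub_left,
        map_smul, inner_smul_left, Complex.conj_I]
      ring
    rw [h1, Complex.add_re, re_inner_weightMul_self hm, sub_add_cancel_left, abs_neg]
    calc _ ≤ ‖Complex.I * inner ℂ (toL2 (weightMul m' φ)) (toL2 (momentum B j φ))‖ :=
          Complex.abs_re_le_norm _
      _ ≤ ‖toL2 (weightMul m' φ)‖ * ‖toL2 (momentum B j φ)‖ := by
          rw [norm_mul, Complex.norm_I, one_mul]; exact norm_inner_le_norm _ _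
      _ ≤ _ := mul_le_mul_of_nonneg_right (norm_weightMul_le hm' ha φ) (norm_nonneg _)
  have k0 := key 0 m₀ hm₀ hd₀ a₀ ha₀
  have k1 := key 1 m₁ hm₁ hd₁ a₁ ha₁
  rw [landauOp_apply, map_add, inner_add_right, Complex.add_re]
  rw [abs_le] at k0 k1 ⊢
  constructor <;> linarith [k0.1, k0.2, k1.1, k1.2]

/-! ### The weights -/

theorem hasTemperateGrowth_inv_one_add_norm_sq (H : Type*) [NormedAddCommGroup H]
    [InnerProductSpace ℝ H] : Function.HasTemperateGrowth (fun x : H => (1 + ‖x‖ ^ 2)⁻¹) := by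
  have := Function.hasTemperateGrowth_one_add_norm_sq_rpow H (-1)
  simpa only [Real.rpow_neg_one] using this

/-- The weight `1 / (1 + |x|²/R²)`. -/
def radialWeight (R : ℝ) (x : Plane) : ℝ := (1 + ‖R⁻¹ • x‖ ^ 2)⁻¹

/-- The weight `1 / (1 + xⱼ²/R²)`. -/
def stripWeight (R : ℝ) (j : Fin 2) (x : Plane) : ℝ := (1 + (R⁻¹ * x j) ^ 2)⁻¹

/-- The bounded function `R arctan(xⱼ/R)`, a primitive of `stripWeight R j` in `xⱼ`. -/
def arctanWeight (R : ℝ) (j : Fin 2) (x : Plane) : ℝ := R * Real.arctan (R⁻¹ * x j)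

theorem hasTemperateGrowth_radialWeight (R : ℝ) : (radialWeight R).HasTemperateGrowth :=
  Function.HasTemperateGrowth.comp (f := fun x : Plane => R⁻¹ • x)
    (hasTemperateGrowth_inv_one_add_norm_sq Plane)
    (R⁻¹ • ContinuousLinearMap.id ℝ Plane).hasTemperateGrowth

theorem hasTemperateGrowth_scaledCoord (R : ℝ) (j : Fin 2) :
    Function.HasTemperateGrowth (fun x : Plane => R⁻¹ * x j) :=
  (Function.HasTemperateGrowth.const R⁻¹).mul (hasTemperateGrowth_coord j)

theorem hasTemperateGrowth_stripWeight (R : ℝ) (j : Fin 2) :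
    (stripWeight R j).HasTemperateGrowth := by
  have := Function.HasTemperateGrowth.comp (f := fun x : Plane => R⁻¹ * x j)
    (hasTemperateGrowth_inv_one_add_norm_sq ℝ) (hasTemperateGrowth_scaledCoord R j)
  simp only [Function.comp_def, Real.norm_eq_abs, sq_abs] at this
  exact this

theorem hasTemperateGrowth_arctan : Real.arctan.HasTemperateGrowth := by
  have hd : fderiv ℝ Real.arctan = fun t => (1 + t ^ 2)⁻¹ • ContinuousLinearMap.id ℝ ℝ := by
    funext t
    rw [(Real.hasDerivAt_arctan' t).hasFDerivAt.fderiv]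
    ext; simp
  refine Function.HasTemperateGrowth.of_fderiv (k := 0) (C := 2) ?_
    (fun t => (Real.hasDerivAt_arctan t).differentiableAt) (fun t => ?_)
  · rw [hd]
    exact Function.HasTemperateGrowth.smul
      (by simpa only [Real.norm_eq_abs, sq_abs] using hasTemperateGrowth_inv_one_add_norm_sq ℝ)
      (Function.HasTemperateGrowth.const (E := ℝ) (ContinuousLinearMap.id ℝ ℝ))
  · rw [pow_zero, mul_one, Real.norm_eq_abs, abs_le]
    have := Real.pi_le_four
    constructor <;> linarith [Real.neg_pi_div_two_lt_arctan t, Real.arctan_lt_pi_div_two t]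

theorem hasTemperateGrowth_arctanWeight (R : ℝ) (j : Fin 2) :
    (arctanWeight R j).HasTemperateGrowth :=
  (Function.HasTemperateGrowth.const R).mul
    (Function.HasTemperateGrowth.comp (f := fun x : Plane => R⁻¹ * x j)
      hasTemperateGrowth_arctan (hasTemperateGrowth_scaledCoord R j))

theorem hasFDerivAt_scaledCoord (R : ℝ) (j : Fin 2) (x : Plane) :
    HasFDerivAt (fun y : Plane => R⁻¹ * y j)
      (R⁻¹ • (EuclideanSpace.proj (𝕜 := ℝ) j : Plane →L[ℝ] ℝ)) x :=
  (R⁻¹ • (EuclideanSpace.proj (𝕜 := ℝ) j : Plane →L[ℝ] ℝ)).hasFDerivAt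

theorem fderiv_arctanWeight {R : ℝ} (hR : R ≠ 0) (i j : Fin 2) (x : Plane) :
    fderiv ℝ (arctanWeight R j) x (EuclideanSpace.single i 1) =
      if i = j then stripWeight R j x else 0 := by
  have h := (((Real.hasDerivAt_arctan' (R⁻¹ * x j)).comp_hasFDerivAt x
    (hasFDerivAt_scaledCoord R j x)).const_mul R)
  have h' : arctanWeight R j = fun y => R * (Real.arctan ∘ fun y : Plane => R⁻¹ * y j) y := rfl
  rw [h', h.fderiv]
  by_cases hij : i = j
  · subst hij; simp [stripWeight]; field_simp
  · have hji : ¬ j = i := fun h => hij h.symm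
    simp [hij, hji]

theorem fderiv_stripWeight (R : ℝ) (i j : Fin 2) (x : Plane) :
    fderiv ℝ (stripWeight R j) x (EuclideanSpace.single i 1) =
      if i = j then -(2 * R⁻¹) * (R⁻¹ * x j) * stripWeight R j x ^ 2 else 0 := by
  have hd : HasDerivAt (fun t : ℝ => (1 + t ^ 2)⁻¹)
      (-(2 * (R⁻¹ * x j)) / (1 + (R⁻¹ * x j) ^ 2) ^ 2) (R⁻¹ * x j) := by
    have := ((hasDerivAt_pow 2 (R⁻¹ * x j)).const_add 1).fun_inv (by positivity)
    simpa using this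
  have h := hd.comp_hasFDerivAt x (hasFDerivAt_scaledCoord R j x)
  have h' : stripWeight R j = (fun t : ℝ => (1 + t ^ 2)⁻¹) ∘ fun y : Plane => R⁻¹ * y j := rfl
  rw [h', h.fderiv]
  by_cases hij : i = j
  · subst hij; simp; ring
  · have hji : ¬ j = i := fun h => hij h.symm
    simp [hij, hji]

theorem fderiv_radialWeight (R : ℝ) (i : Fin 2) (x : Plane) :
    fderiv ℝ (radialWeight R) x (EuclideanSpace.single i 1) =
      -(2 * R⁻¹) * (R⁻¹ * x i) * radialWeight R x ^ 2 := by
  have h1 : HasFDerivAt (fun y : Plane => R⁻¹ • y) (R⁻¹ • ContinuousLinearMap.id ℝ Plane) x :=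
    (R⁻¹ • ContinuousLinearMap.id ℝ Plane).hasFDerivAt
  have h2 := h1.norm_sq
  have hd : HasDerivAt (fun t : ℝ => (1 + t)⁻¹)
      (-1 / (1 + ‖R⁻¹ • x‖ ^ 2) ^ 2) (‖R⁻¹ • x‖ ^ 2) := by
    have := ((hasDerivAt_id (‖R⁻¹ • x‖ ^ 2)).const_add 1).fun_inv (by simp; positivity)
    simpa using this
  have h := hd.comp_hasFDerivAt x h2
  have h' : radialWeight R = (fun t : ℝ => (1 + t)⁻¹) ∘ fun y : Plane => ‖R⁻¹ • y‖ ^ 2 := rfl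
  rw [h', h.fderiv]
  simp [EuclideanSpace.inner_single_right]
  ring

/-- The bound behind the estimates of the derivatives of the weights. -/
theorem abs_two_inv_mul_le {R t s : ℝ} (hR : 1 ≤ R) (hts : t ^ 2 ≤ s) :
    |-(2 * R⁻¹) * t * (1 + s)⁻¹ ^ 2| ≤ 1 := by
  have hs : 0 ≤ s := (sq_nonneg t).trans hts
  have hR' : R⁻¹ ≤ 1 := inv_le_one_of_one_le₀ hR
  have hR0 : 0 ≤ R⁻¹ := by positivity
  rw [abs_mul, abs_mul, abs_neg, abs_of_nonneg (by positivity : 0 ≤ 2 * R⁻¹),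
    abs_of_nonneg (by positivity : 0 ≤ (1 + s)⁻¹ ^ 2), inv_pow, ← div_eq_mul_inv,
    div_le_one (by positivity)]
  have h1 : 2 * |t| ≤ 1 + s := by nlinarith [sq_abs t, sq_nonneg (|t| - 1)]
  have h2 : 2 * R⁻¹ * |t| ≤ 2 * |t| := by nlinarith [abs_nonneg t]
  nlinarith

theorem abs_inv_one_add_le_one {s : ℝ} (hs : 0 ≤ s) : |(1 + s)⁻¹| ≤ 1 := by
  rw [abs_of_nonneg (by positivity)]
  exact inv_le_one_of_one_le₀ (by linarith)

theorem abs_stripWeight_le (R : ℝ) (j : Fin 2) (x : Plane) : |stripWeight R j x| ≤ 1 :=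
  abs_inv_one_add_le_one (sq_nonneg _)

theorem abs_radialWeight_le (R : ℝ) (x : Plane) : |radialWeight R x| ≤ 1 :=
  abs_inv_one_add_le_one (sq_nonneg _)

theorem abs_arctanWeight_le {R : ℝ} (hR : 0 ≤ R) (j : Fin 2) (x : Plane) :
    |arctanWeight R j x| ≤ 2 * R := by
  rw [arctanWeight, abs_mul, abs_of_nonneg hR, mul_comm]
  refine mul_le_mul_of_nonneg_right (abs_le.2 ?_) hR
  have := Real.pi_le_four
  constructor <;> linarith [Real.neg_pi_div_two_lt_arctan (R⁻¹ * x j),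
    Real.arctan_lt_pi_div_two (R⁻¹ * x j)]

theorem scaledCoord_sq_le (R : ℝ) (j : Fin 2) (x : Plane) :
    (R⁻¹ * x j) ^ 2 ≤ ‖R⁻¹ • x‖ ^ 2 := by
  have h := PiLp.norm_apply_le (R⁻¹ • x) j
  rw [PiLp.smul_apply, smul_eq_mul, Real.norm_eq_abs] at h
  rw [← sq_abs]
  gcongr

theorem radialWeight_le_stripWeight (R : ℝ) (j : Fin 2) (x : Plane) :
    radialWeight R x ≤ stripWeight R j x :=
  inv_anti₀ (by positivity) (by linarith [scaledCoord_sq_le R j x])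

/-! ### Quasimodes put little mass near the origin -/

theorem norm_momentum_sq_le {B z M U : ℝ} (hz : 0 < z) {φ : 𝓢(Plane, ℂ)} (hU : ‖toL2 φ‖ ≤ U)
    (hg : ‖toL2 (landauOp B φ - (z : ℂ) • φ)‖ ≤ M * U) :
    ‖toL2 (momentum B 0 φ)‖ ^ 2 + ‖toL2 (momentum B 1 φ)‖ ^ 2 ≤ (z + M) * U ^ 2 := by
  have hU0 : 0 ≤ U := (norm_nonneg _).trans hU
  have h := inner_landauOp_self B φ
  have h1 : landauOp B φ = (landauOp B φ - (z : ℂ) • φ) + (z : ℂ) • φ := by module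
  rw [h1, map_add, inner_add_right, map_smul, inner_smul_right, inner_self_eq_norm_sq_to_K] at h
  have h2 := congrArg Complex.re h
  rw [Complex.ofReal_re, Complex.add_re] at h2
  have h3 : ((z : ℂ) * ((‖toL2 φ‖ : ℝ) : ℂ) ^ 2).re = z * ‖toL2 φ‖ ^ 2 := by
    rw [← Complex.ofReal_pow, Complex.re_ofReal_mul, Complex.ofReal_re]
  have h4 : (inner ℂ (toL2 φ) (toL2 (landauOp B φ - (z : ℂ) • φ))).re ≤ U * (M * U) :=
    (Complex.re_le_norm _).trans ((norm_inner_le_norm _ _).trans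
      (mul_le_mul hU hg (norm_nonneg _) hU0))
  have h5 : z * ‖toL2 φ‖ ^ 2 ≤ z * U ^ 2 := by gcongr
  rw [← h2]
  refine (add_le_add h4 (h3.le.trans h5)).trans (le_of_eq ?_)
  ring

theorem landauOp_apply' (B : ℝ) (φ : 𝓢(Plane, ℂ)) :
    landauOp B φ = momentum B 1 (momentum B 1 φ) + momentum B 0 (momentum B 0 φ) := by
  rw [landauOp_apply, add_comm]

theorem momentum_zero_momentum_one_apply (B : ℝ) (φ : 𝓢(Plane, ℂ)) :
    momentum B 0 (momentum B 1 φ) =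
      momentum B 1 (momentum B 0 φ) + (Complex.I * B) • φ :=
  LinearMap.congr_fun (momentum_zero_mul_momentum_one B) φ

theorem abs_inner_weightMul_le {m : Plane → ℝ} (hm : m.HasTemperateGrowth) {C a b : ℝ}
    (hC0 : 0 ≤ C) (hC : ∀ x, |m x| ≤ C) {φ ψ : 𝓢(Plane, ℂ)} (hφ : ‖toL2 φ‖ ≤ a)
    (hψ : ‖toL2 ψ‖ ≤ b) : ‖inner ℂ (toL2 (weightMul m φ)) (toL2 ψ)‖ ≤ C * a * b := by
  have h1 : ‖toL2 (weightMul m φ)‖ ≤ C * a :=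
    (norm_weightMul_le hm hC φ).trans (by gcongr)
  exact (norm_inner_le_norm _ _).trans
    (mul_le_mul h1 hψ (norm_nonneg _) ((norm_nonneg _).trans h1))

/-- The virial identity with the local energy identity bounds the kinetic energy in the `j`-th
direction in the strip `|xⱼ| ≲ R`. -/
theorem weightedMass_stripWeight_momentum_le {B z M U R : ℝ} (hB : 0 < B) (hz : 0 < z)
    (hM : 1 ≤ M) (hR : 1 ≤ R) {φ : 𝓢(Plane, ℂ)} (hU : ‖toL2 φ‖ ≤ U)
    (hg : ‖toL2 (landauOp B φ - (z : ℂ) • φ)‖ ≤ M * U) (j : Fin 2) :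
    2 * weightedMass (stripWeight R j) (momentum B j φ) ≤
      (4 * R * √(z + M) * (M + B) + M + √(z + M)) * U ^ 2 := by
  have hU0 : 0 ≤ U := (norm_nonneg _).trans hU
  have hp := norm_momentum_sq_le hz hU hg
  have hpj : ∀ i, ‖toL2 (momentum B i φ)‖ ≤ √(z + M) * U := by
    intro i
    refine abs_le_of_sq_le_sq' ?_ (by positivity) |>.2
    rw [mul_pow, Real.sq_sqrt (by positivity)]
    have h0 := sq_nonneg ‖toL2 (momentum B 0 φ)‖
    have h1 := sq_nonneg ‖toL2 (momentum B 1 φ)‖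
    fin_cases i
    · simp only [Fin.zero_eta]; linarith
    · simp only [Fin.mk_one]; linarith
  have hη := hasTemperateGrowth_stripWeight R j
  have hγ := hasTemperateGrowth_arctanWeight R j
  have hγb := abs_arctanWeight_le (zero_le_one.trans hR) j
  have hR2 : 0 ≤ 2 * R := by linarith
  -- The energy identity with the weight `stripWeight R j`.
  have henergy : weightedMass (stripWeight R j) (momentum B 0 φ) +
      weightedMass (stripWeight R j) (momentum B 1 φ) - z * weightedMass (stripWeight R j) φ ≤
      M * U ^ 2 + √(z + M) * U ^ 2 := by
    have h0 := Function.HasTemperateGrowth.const (E := Plane) (0 : ℝ)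
    have hη' : Function.HasTemperateGrowth
        (fun x => -(2 * R⁻¹) * (R⁻¹ * x j) * stripWeight R j x ^ 2) :=
      ((Function.HasTemperateGrowth.const _).mul (hasTemperateGrowth_scaledCoord R j)).mul
        (hη.pow 2)
    have hb : ∀ x : Plane, |-(2 * R⁻¹) * (R⁻¹ * x j) * stripWeight R j x ^ 2| ≤ 1 :=
      fun x => abs_two_inv_mul_le hR le_rfl
    have h1 : |weightedMass (stripWeight R j) (momentum B 0 φ) +
        weightedMass (stripWeight R j) (momentum B 1 φ) -
        (inner ℂ (toL2 (weightMul (stripWeight R j) φ)) (toL2 (landauOp B φ))).re| ≤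
        √(z + M) * U ^ 2 := by
      have hle : ∀ i, ‖toL2 φ‖ * ‖toL2 (momentum B i φ)‖ ≤ √(z + M) * U ^ 2 := by
        intro i
        refine (mul_le_mul hU (hpj i) (norm_nonneg _) hU0).trans (le_of_eq ?_)
        ring
      fin_cases j
      · refine (abs_weighted_energy_sub_le B hη hη' h0 (fun x => ?_) (fun x => ?_) hb
          (a₁ := 0) (by simp) φ).trans ?_
        · simp [fderiv_stripWeight]
        · simp [fderiv_stripWeight]
        · simpa using hle 0
      · refine (abs_weighted_energy_sub_le B hη h0 hη' (fun x => ?_) (fun x => ?_)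
          (a₀ := 0) (by simp) hb φ).trans ?_
        · simp [fderiv_stripWeight]
        · simp [fderiv_stripWeight]
        · simpa using hle 1
    have h2 : (inner ℂ (toL2 (weightMul (stripWeight R j) φ)) (toL2 (landauOp B φ))).re =
        (inner ℂ (toL2 (weightMul (stripWeight R j) φ))
          (toL2 (landauOp B φ - (z : ℂ) • φ))).re + z * weightedMass (stripWeight R j) φ := by
      rw [map_sub, inner_sub_right, map_smul, inner_smul_right, Complex.sub_re,
        Complex.re_ofReal_mul, re_inner_weightMul_self hη]
      ring
    have h3 : (inner ℂ (toL2 (weightMul (stripWeight R j) φ))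
        (toL2 (landauOp B φ - (z : ℂ) • φ))).re ≤ 1 * U * (M * U) :=
      (Complex.re_le_norm _).trans
        (abs_inner_weightMul_le hη zero_le_one (abs_stripWeight_le R j) hU hg)
    have h4 := (abs_le.1 h1).2
    nlinarith
  have hvirial : ∀ (k : Fin 2) (β : ℝ), |β| = B → k ≠ j →
      (∀ φ, landauOp B φ = momentum B j (momentum B j φ) + momentum B k (momentum B k φ)) →
      (∀ φ, momentum B k (momentum B j φ) =
        momentum B j (momentum B k φ) - (Complex.I * β) • φ) →
      weightedMass (stripWeight R j) (momentum B j φ) -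
        weightedMass (stripWeight R j) (momentum B k φ) + z * weightedMass (stripWeight R j) φ ≤
        4 * R * √(z + M) * (M + B) * U ^ 2 := by
    intro k β hβ hkj hH hcomm
    rw [virial_identity B hH hcomm hγ hη
      (fun x => by simp [fderiv_arctanWeight (by linarith : R ≠ 0)])
      (fun x => by simp [fderiv_arctanWeight (by linarith : R ≠ 0), hkj]) z φ]
    have h1 : (inner ℂ (toL2 (weightMul (arctanWeight R j) (momentum B j φ)))
        (toL2 (landauOp B φ - (z : ℂ) • φ))).im ≤ 2 * R * (√(z + M) * U) * (M * U) :=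
      (Complex.im_le_norm _).trans (abs_inner_weightMul_le hγ hR2 hγb (hpj j) hg)
    have h2 : -(β * (inner ℂ (toL2 (weightMul (arctanWeight R j) φ))
        (toL2 (momentum B k φ))).re) ≤ B * (2 * R * U * (√(z + M) * U)) := by
      refine (neg_le_abs _).trans ?_
      rw [abs_mul, hβ]
      exact mul_le_mul_of_nonneg_left ((Complex.abs_re_le_norm _).trans
        (abs_inner_weightMul_le hγ hR2 hγb hU (hpj k))) hB.le
    linarith
  fin_cases j
  · have := hvirial 1 B (abs_of_pos hB) (by simp) (landauOp_apply B) fun φ => by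
      simp only [Fin.zero_eta]
      rw [momentum_zero_momentum_one_apply]; module
    simp only [Fin.zero_eta] at this henergy ⊢
    linarith
  · have := hvirial 0 (-B) (by rw [abs_neg, abs_of_pos hB]) (by simp) (landauOp_apply' B)
      fun φ => by
        simp only [Fin.mk_one]
        rw [momentum_zero_momentum_one_apply]; push_cast; module
    simp only [Fin.mk_one] at this henergy ⊢
    linarith

/-- A classical cyclotron orbit of energy `z` has radius of order `√z` and spends at most a
fraction of order `R / √z` of its time in a disc of radius `R`. This is the quantum version,
for functions `φ` with `‖(H₀ - z)φ‖` bounded. -/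
theorem weightedMass_radialWeight_le {B z M U R : ℝ} (hB : 0 < B) (hz : 0 < z)
    (hM : 1 ≤ M) (hR : 1 ≤ R) {φ : 𝓢(Plane, ℂ)} (hU : ‖toL2 φ‖ ≤ U)
    (hg : ‖toL2 (landauOp B φ - (z : ℂ) • φ)‖ ≤ M * U) :
    z * weightedMass (radialWeight R) φ ≤
      (4 * (M + B) + 2 * M + 3) * (R * √(z + M)) * U ^ 2 := by
  have hU0 : 0 ≤ U := (norm_nonneg _).trans hU
  have hp := norm_momentum_sq_le hz hU hg
  have hs := hasTemperateGrowth_radialWeight R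
  have hdir : ∀ j, 2 * weightedMass (radialWeight R) (momentum B j φ) ≤
      (4 * R * √(z + M) * (M + B) + M + √(z + M)) * U ^ 2 := by
    intro j
    refine le_trans ?_ (weightedMass_stripWeight_momentum_le hB hz hM hR hU hg j)
    have := weightedMass_mono hs.1.continuous
      (hasTemperateGrowth_stripWeight R j).1.continuous (abs_radialWeight_le R)
      (abs_stripWeight_le R j) (radialWeight_le_stripWeight R j) (momentum B j φ)
    linarith
  have hd : ∀ i : Fin 2, Function.HasTemperateGrowth
      (fun x : Plane => -(2 * R⁻¹) * (R⁻¹ * x i) * radialWeight R x ^ 2) := fun i =>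
    ((Function.HasTemperateGrowth.const _).mul (hasTemperateGrowth_scaledCoord R i)).mul
      (hs.pow 2)
  have hb : ∀ (i : Fin 2) (x : Plane),
      |-(2 * R⁻¹) * (R⁻¹ * x i) * radialWeight R x ^ 2| ≤ 1 :=
    fun i x => abs_two_inv_mul_le hR (scaledCoord_sq_le R i x)
  have h1 := abs_weighted_energy_sub_le B hs (hd 0) (hd 1) (fderiv_radialWeight R 0)
    (fderiv_radialWeight R 1) (hb 0) (hb 1) φ
  have hpj : ∀ a : ℝ, 0 ≤ a → a ^ 2 ≤ (z + M) * U ^ 2 → a ≤ √(z + M) * U := by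
    intro a ha h
    refine abs_le_of_sq_le_sq' ?_ (by positivity) |>.2
    rwa [mul_pow, Real.sq_sqrt (by positivity)]
  have hle : ∀ i : Fin 2, ‖toL2 (momentum B i φ)‖ ^ 2 ≤ (z + M) * U ^ 2 →
      1 * ‖toL2 φ‖ * ‖toL2 (momentum B i φ)‖ ≤ √(z + M) * U ^ 2 := by
    intro i hi
    rw [one_mul]
    refine (mul_le_mul hU (hpj _ (norm_nonneg _) hi) (norm_nonneg _) hU0).trans (le_of_eq ?_)
    ring
  have hle0 := hle 0 (by linarith [sq_nonneg ‖toL2 (momentum B 1 φ)‖])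
  have hle1 := hle 1 (by linarith [sq_nonneg ‖toL2 (momentum B 0 φ)‖])
  have h2 : (inner ℂ (toL2 (weightMul (radialWeight R) φ)) (toL2 (landauOp B φ))).re =
      (inner ℂ (toL2 (weightMul (radialWeight R) φ))
        (toL2 (landauOp B φ - (z : ℂ) • φ))).re + z * weightedMass (radialWeight R) φ := by
    rw [map_sub, inner_sub_right, map_smul, inner_smul_right, Complex.sub_re,
      Complex.re_ofReal_mul, re_inner_weightMul_self hs]
    ring
  have h3 : -(inner ℂ (toL2 (weightMul (radialWeight R) φ))
      (toL2 (landauOp B φ - (z : ℂ) • φ))).re ≤ 1 * U * (M * U) :=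
    (neg_le_abs _).trans ((Complex.abs_re_le_norm _).trans
      (abs_inner_weightMul_le hs zero_le_one (abs_radialWeight_le R) hU hg))
  have h4 := (abs_le.1 h1).1
  have hd0 := hdir 0
  have hd1 := hdir 1
  have he1 : 1 ≤ √(z + M) := by
    rw [Real.one_le_sqrt]; linarith
  have hRe : √(z + M) ≤ R * √(z + M) := le_mul_of_one_le_left (by positivity) hR
  have hM2 : M ≤ M * (R * √(z + M)) := le_mul_of_one_le_right (by linarith) (he1.trans hRe)
  have hfin : (4 * R * √(z + M) * (M + B) + 2 * M + 3 * √(z + M)) * U ^ 2 ≤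
      (4 * (M + B) + 2 * M + 3) * (R * √(z + M)) * U ^ 2 := by
    refine mul_le_mul_of_nonneg_right ?_ (sq_nonneg U)
    linarith
  refine le_trans ?_ hfin
  linarith

theorem one_le_japaneseBracket (x : Plane) : 1 ≤ japaneseBracket x := by
  rw [japaneseBracket, Real.one_le_sqrt]
  linarith [sq_nonneg ‖x‖]

theorem continuous_bracket_rpow (ρ : ℝ) : Continuous fun x => japaneseBracket x ^ (-ρ) := by
  have h : Continuous japaneseBracket := by unfold japaneseBracket; fun_prop
  exact h.rpow_const fun x => Or.inl (by linarith [one_le_japaneseBracket x])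

theorem bracket_rpow_le_one {ρ : ℝ} (hρ : 0 < ρ) (x : Plane) : japaneseBracket x ^ (-ρ) ≤ 1 :=
  Real.rpow_le_one_of_one_le_of_nonpos (one_le_japaneseBracket x) (by linarith)

theorem abs_bracket_rpow_le_one {ρ : ℝ} (hρ : 0 < ρ) (x : Plane) :
    |japaneseBracket x ^ (-ρ)| ≤ 1 := by
  rw [abs_of_nonneg (Real.rpow_nonneg (zero_le_one.trans (one_le_japaneseBracket x)) _)]
  exact bracket_rpow_le_one hρ x

theorem half_le_radialWeight {R : ℝ} (hR : 0 < R) {x : Plane} (hx : japaneseBracket x ≤ R) :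
    1 / 2 ≤ radialWeight R x := by
  have h1 : ‖x‖ ≤ R := by
    refine le_trans ?_ hx
    rw [japaneseBracket]
    refine Real.le_sqrt_of_sq_le (by linarith)
  have h2 : ‖R⁻¹ • x‖ ≤ 1 := by
    rw [norm_smul, Real.norm_eq_abs, abs_of_pos (by positivity), inv_mul_le_iff₀ hR]
    linarith
  rw [radialWeight, one_div]
  refine inv_anti₀ (by positivity) ?_
  have := pow_le_one₀ (n := 2) (norm_nonneg _) h2
  linarith

/-- Dyadic decomposition of the weight `⟨x⟩^{-ρ}`. -/
theorem bracket_rpow_le_sum {ρ : ℝ} (hρ : 0 < ρ) (n : ℕ) (x : Plane) :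
    japaneseBracket x ^ (-ρ) ≤
      2 * ∑ k ∈ Finset.range n, ((2 : ℝ) ^ k) ^ (-ρ) * radialWeight (2 ^ (k + 1)) x +
        ((2 : ℝ) ^ n) ^ (-ρ) := by
  have hpos : ∀ k, 0 ≤ ((2 : ℝ) ^ k) ^ (-ρ) * radialWeight (2 ^ (k + 1)) x := fun k =>
    mul_nonneg (by positivity) (by rw [radialWeight]; positivity)
  induction n with
  | zero => simpa using bracket_rpow_le_one hρ x
  | succ n ih =>
    rcases le_total (japaneseBracket x) (2 ^ (n + 1)) with h | h
    · have h1 := half_le_radialWeight (by positivity) h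
      have h2 : ((2 : ℝ) ^ n) ^ (-ρ) * (1 / 2) ≤
          ((2 : ℝ) ^ n) ^ (-ρ) * radialWeight (2 ^ (n + 1)) x := by gcongr
      have h3 : (0 : ℝ) ≤ ((2 : ℝ) ^ (n + 1)) ^ (-ρ) := by positivity
      rw [Finset.sum_range_succ]
      linarith
    · have h1 : japaneseBracket x ^ (-ρ) ≤ ((2 : ℝ) ^ (n + 1)) ^ (-ρ) :=
        Real.rpow_le_rpow_of_nonpos (by positivity) h (by linarith)
      have h2 := Finset.sum_nonneg fun k (_ : k ∈ Finset.range (n + 1)) => hpos k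
      linarith

theorem weightedMass_bracket_le_sum {ρ : ℝ} (hρ : 0 < ρ) (n : ℕ) (φ : 𝓢(Plane, ℂ)) :
    weightedMass (fun x => japaneseBracket x ^ (-ρ)) φ ≤
      2 * ∑ k ∈ Finset.range n, ((2 : ℝ) ^ k) ^ (-ρ) * weightedMass (radialWeight (2 ^ (k + 1))) φ +
        ((2 : ℝ) ^ n) ^ (-ρ) * ‖toL2 φ‖ ^ 2 := by
  have hi : ∀ k : ℕ, Integrable (fun x => radialWeight (2 ^ (k + 1)) x * ‖φ x‖ ^ 2) := fun k =>
    integrable_weight_mul_norm_sq (hasTemperateGrowth_radialWeight _).1.continuous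
      (abs_radialWeight_le _) φ
  have hs : Integrable (fun x => ∑ k ∈ Finset.range n,
      ((2 : ℝ) ^ k) ^ (-ρ) * (radialWeight (2 ^ (k + 1)) x * ‖φ x‖ ^ 2)) :=
    integrable_finsetSum _ fun k _ => (hi k).const_mul _
  have hrhs : 2 * ∑ k ∈ Finset.range n, ((2 : ℝ) ^ k) ^ (-ρ) *
      weightedMass (radialWeight (2 ^ (k + 1))) φ + ((2 : ℝ) ^ n) ^ (-ρ) * ‖toL2 φ‖ ^ 2 =
      ∫ x, (2 * ∑ k ∈ Finset.range n,
        ((2 : ℝ) ^ k) ^ (-ρ) * (radialWeight (2 ^ (k + 1)) x * ‖φ x‖ ^ 2)) +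
          ((2 : ℝ) ^ n) ^ (-ρ) * ‖φ x‖ ^ 2 := by
    rw [integral_add (hs.const_mul 2) ((integrable_norm_sq φ).const_mul _), integral_const_mul,
      integral_const_mul, integral_norm_sq, integral_finsetSum _ fun k _ => (hi k).const_mul _]
    simp only [integral_const_mul, weightedMass]
  rw [hrhs]
  refine integral_mono (integrable_weight_mul_norm_sq (continuous_bracket_rpow ρ)
    (abs_bracket_rpow_le_one hρ) φ)
    ((hs.const_mul 2).add ((integrable_norm_sq φ).const_mul _)) fun x => ?_
  have h := mul_le_mul_of_nonneg_right (bracket_rpow_le_sum hρ n x) (sq_nonneg ‖φ x‖)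
  refine h.trans (le_of_eq ?_)
  simp only [add_mul, Finset.sum_mul, mul_assoc]

/-- Functions `φ` with `‖(H₀ - z)φ‖` bounded satisfy `∫ ⟨x⟩^{-ρ} |φ|² = O(z^{-ρ/2})`. The geometric
sum over the dyadic scales up to `√z` is dominated by its last term because `ρ < 1`. -/
theorem exists_weightedMass_bracket_le {B ρ M : ℝ} (hB : 0 < B) (hρ0 : 0 < ρ) (hρ1 : ρ < 1)
    (hM : 1 ≤ M) : ∃ K : ℝ, 0 < K ∧ ∀ (z U : ℝ) (φ : 𝓢(Plane, ℂ)), B ≤ z → ‖toL2 φ‖ ≤ U →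
      ‖toL2 (landauOp B φ - (z : ℂ) • φ)‖ ≤ M * U →
      weightedMass (fun x => japaneseBracket x ^ (-ρ)) φ ≤ K * z ^ (-(ρ / 2)) * U ^ 2 := by
  set r : ℝ := 2 ^ (1 - ρ) with hr
  have hr1 : 1 < r := Real.one_lt_rpow one_lt_two (by linarith)
  set A : ℝ := 4 * (M + B) + 2 * M + 3 with hA
  have hA0 : 0 < A := by positivity
  set κ : ℝ := √(1 + M / B) with hκ
  refine ⟨4 * A * κ / (r - 1) + 2 ^ ρ, ?_, fun z U φ hz hU hg => ?_⟩
  · have : 0 < r - 1 := by linarith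
    positivity
  have hr0 : 0 < r - 1 := by linarith
  have hz0 : 0 < z := hB.trans_le hz
  have hU0 : 0 ≤ U := (norm_nonneg _).trans hU
  have hU2 : ‖toL2 φ‖ ^ 2 ≤ U ^ 2 := by gcongr
  rcases lt_or_ge z 1 with hz1 | hz1
  · have h := weightedMass_bracket_le_sum hρ0 0 φ
    simp only [Finset.range_zero, Finset.sum_empty, mul_zero, zero_add, pow_zero,
      Real.one_rpow, one_mul] at h
    have h1 : 1 ≤ z ^ (-(ρ / 2)) :=
      Real.one_le_rpow_of_pos_of_le_one_of_nonpos hz0 hz1.le (by linarith)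
    have h2 : (1 : ℝ) ≤ 2 ^ ρ := Real.one_le_rpow one_le_two hρ0.le
    have h3 : 0 ≤ 4 * A * κ / (r - 1) := by positivity
    have h4 : 1 ≤ (4 * A * κ / (r - 1) + 2 ^ ρ) * z ^ (-(ρ / 2)) := by nlinarith
    exact (h.trans hU2).trans (le_mul_of_one_le_left (sq_nonneg U) h4)
  · set s : ℝ := √z with hs
    have hs1 : 1 ≤ s := Real.one_le_sqrt.2 hz1
    have hs0 : 0 < s := zero_lt_one.trans_le hs1
    have hsz : s ^ 2 = z := Real.sq_sqrt hz0.le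
    obtain ⟨n, hn1, hn2⟩ := exists_nat_pow_near hs1 one_lt_two
    have hzs : z ^ (-(ρ / 2)) = s ^ (-ρ) := by
      rw [← hsz, ← Real.rpow_natCast, ← Real.rpow_mul hs0.le]
      congr 1; push_cast; ring
    have he : √(z + M) ≤ κ * s := by
      rw [hκ, hs, ← Real.sqrt_mul (by positivity)]
      refine Real.sqrt_le_sqrt ?_
      have : M ≤ M / B * z := by
        rw [div_mul_eq_mul_div, le_div_iff₀ hB]; gcongr
      linarith
    have hpow : ∀ k : ℕ, ((2 : ℝ) ^ k) ^ (-ρ) * 2 ^ k = r ^ k := by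
      intro k
      rw [hr, ← Real.rpow_natCast 2 k, ← Real.rpow_mul zero_le_two, ← Real.rpow_add two_pos,
        ← Real.rpow_natCast (2 ^ (1 - ρ)) k, ← Real.rpow_mul zero_le_two]
      congr 1; ring
    have hgeom : ∑ k ∈ Finset.range n, r ^ k ≤ s ^ (1 - ρ) / (r - 1) := by
      rw [geom_sum_eq hr1.ne']
      have : r ^ n ≤ s ^ (1 - ρ) := by
        have h1 : r ^ n = ((2 : ℝ) ^ n) ^ (1 - ρ) := by
          rw [hr, ← Real.rpow_natCast 2 n, ← Real.rpow_mul zero_le_two,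
            ← Real.rpow_natCast (2 ^ (1 - ρ)) n, ← Real.rpow_mul zero_le_two, mul_comm]
        rw [h1]
        exact Real.rpow_le_rpow (by positivity) hn1 (by linarith)
      gcongr
      linarith
    have hterm : ∀ k : ℕ, z * (((2 : ℝ) ^ k) ^ (-ρ) * weightedMass (radialWeight (2 ^ (k + 1))) φ) ≤
        2 * A * κ * s * U ^ 2 * r ^ k := by
      intro k
      have h := weightedMass_radialWeight_le hB hz0 hM
        (R := 2 ^ (k + 1)) (one_le_pow₀ one_le_two) hU hg
      calc z * (((2 : ℝ) ^ k) ^ (-ρ) * weightedMass (radialWeight (2 ^ (k + 1))) φ)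
          = ((2 : ℝ) ^ k) ^ (-ρ) * (z * weightedMass (radialWeight (2 ^ (k + 1))) φ) := by ring
        _ ≤ ((2 : ℝ) ^ k) ^ (-ρ) * (A * (2 ^ (k + 1) * √(z + M)) * U ^ 2) := by gcongr
        _ ≤ ((2 : ℝ) ^ k) ^ (-ρ) * (A * (2 ^ (k + 1) * (κ * s)) * U ^ 2) := by gcongr
        _ = 2 * A * κ * s * U ^ 2 * (((2 : ℝ) ^ k) ^ (-ρ) * 2 ^ k) := by ring
        _ = _ := by rw [hpow]
    have hlast : ((2 : ℝ) ^ n) ^ (-ρ) ≤ 2 ^ ρ * s ^ (-ρ) := by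
      have h1 : s / 2 ≤ 2 ^ n := by
        rw [pow_succ] at hn2; linarith
      calc ((2 : ℝ) ^ n) ^ (-ρ) ≤ (s / 2) ^ (-ρ) :=
            Real.rpow_le_rpow_of_nonpos (by positivity) h1 (by linarith)
        _ = _ := by
            rw [Real.div_rpow hs0.le zero_le_two, Real.rpow_neg zero_le_two]
            field_simp
    have hmain : z * weightedMass (fun x => japaneseBracket x ^ (-ρ)) φ ≤
        z * ((4 * A * κ / (r - 1) + 2 ^ ρ) * z ^ (-(ρ / 2)) * U ^ 2) := by
      calc z * weightedMass (fun x => japaneseBracket x ^ (-ρ)) φ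
          ≤ z * (2 * ∑ k ∈ Finset.range n, ((2 : ℝ) ^ k) ^ (-ρ) *
              weightedMass (radialWeight (2 ^ (k + 1))) φ + ((2 : ℝ) ^ n) ^ (-ρ) * ‖toL2 φ‖ ^ 2) := by
            gcongr
            exact weightedMass_bracket_le_sum hρ0 n φ
        _ = 2 * ∑ k ∈ Finset.range n, z * (((2 : ℝ) ^ k) ^ (-ρ) *
              weightedMass (radialWeight (2 ^ (k + 1))) φ) +
              z * (((2 : ℝ) ^ n) ^ (-ρ) * ‖toL2 φ‖ ^ 2) := by
            rw [← Finset.mul_sum]; ring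
        _ ≤ 2 * ∑ k ∈ Finset.range n, 2 * A * κ * s * U ^ 2 * r ^ k +
              z * ((2 ^ ρ * s ^ (-ρ)) * U ^ 2) := by
            have h := Finset.sum_le_sum fun k (_ : k ∈ Finset.range n) => hterm k
            have h' := mul_le_mul_of_nonneg_left hlast hz0.le
            have h'' := mul_le_mul h' hU2 (sq_nonneg _) (by positivity)
            linarith
        _ = 4 * A * κ * s * U ^ 2 * ∑ k ∈ Finset.range n, r ^ k +
              z * ((2 ^ ρ * s ^ (-ρ)) * U ^ 2) := by
            rw [← Finset.mul_sum]; ring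
        _ ≤ 4 * A * κ * s * U ^ 2 * (s ^ (1 - ρ) / (r - 1)) +
              z * ((2 ^ ρ * s ^ (-ρ)) * U ^ 2) := by gcongr
        _ = _ := by
            rw [hzs, sub_eq_add_neg 1 ρ, Real.rpow_add hs0, Real.rpow_one, ← hsz]
            ring
    exact le_of_mul_le_mul_left hmain hz0

/-! ### The a priori estimate on finite sums of eigenfunctions -/

theorem inner_landauEigenspace_eq_zero {B : ℝ} (hB : 0 < B) {p q : ℕ} (hpq : p ≠ q)
    {φ ψ : 𝓢(Plane, ℂ)} (hφ : φ ∈ landauEigenspace B p) (hψ : ψ ∈ landauEigenspace B q) :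
    inner ℂ (toL2 φ) (toL2 ψ) = 0 := by
  rw [mem_landauEigenspace] at hφ hψ
  have h := inner_landauOp_left B φ ψ
  rw [hφ, hψ, map_smul, map_smul, inner_smul_left, inner_smul_right, Complex.conj_ofReal,
    ← sub_eq_zero, ← sub_mul] at h
  refine (mul_eq_zero.1 h).resolve_left ?_
  rw [← Complex.ofReal_sub, Complex.ofReal_eq_zero, sub_eq_zero, landauLevel, landauLevel]
  intro h'
  have h2 := mul_left_cancel₀ hB.ne' h'
  exact hpq (by exact_mod_cast (by linarith : (p : ℝ) = q))

/-- Parseval's identity for finite combinations of eigenfunctions. -/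
theorem inner_sum_landauEigenspace {B : ℝ} (hB : 0 < B) {f : ℕ → 𝓢(Plane, ℂ)}
    (hf : ∀ q, f q ∈ landauEigenspace B q) (s : Finset ℕ) (α β : ℕ → ℝ) :
    inner ℂ (toL2 (∑ q ∈ s, (α q : ℂ) • f q)) (toL2 (∑ q ∈ s, (β q : ℂ) • f q)) =
      ((∑ q ∈ s, α q * β q * ‖toL2 (f q)‖ ^ 2 : ℝ) : ℂ) := by
  simp only [map_sum, map_smul, sum_inner, inner_smul_left, Complex.conj_ofReal]
  rw [Complex.ofReal_sum]
  refine Finset.sum_congr rfl fun p hp => ?_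
  rw [inner_sum, Finset.sum_eq_single p]
  · rw [inner_smul_right, inner_self_eq_norm_sq_to_K]
    push_cast
    exact (mul_assoc _ _ _).symm
  · intro q _ hq
    rw [inner_smul_right, inner_landauEigenspace_eq_zero hB hq.symm (hf p) (hf q), mul_zero]
  · exact fun h => absurd hp h

theorem norm_sq_sum_landauEigenspace {B : ℝ} (hB : 0 < B) {f : ℕ → 𝓢(Plane, ℂ)}
    (hf : ∀ q, f q ∈ landauEigenspace B q) (s : Finset ℕ) (α : ℕ → ℝ) :
    ‖toL2 (∑ q ∈ s, (α q : ℂ) • f q)‖ ^ 2 = ∑ q ∈ s, α q ^ 2 * ‖toL2 (f q)‖ ^ 2 := by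
  have h := inner_sum_landauEigenspace hB hf s α α
  rw [inner_self_eq_norm_sq_to_K] at h
  simp only [← pow_two] at h
  apply Complex.ofReal_injective
  rw [← h]; push_cast; rfl

/-- The reflection `v = sgn(H₀ - z) u`: it has the same norm as `u`, also after application of
`H₀ - z`, and turns `⟨u, (H₀ - z)u⟩` into `⟨u, |H₀ - z|u⟩`. -/
theorem exists_sign_reflection {B : ℝ} (hB : 0 < B) (z : ℝ) {u : 𝓢(Plane, ℂ)}
    (hu : u ∈ landauSpan B) :
    ∃ v : 𝓢(Plane, ℂ), ‖toL2 v‖ = ‖toL2 u‖ ∧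
      ‖toL2 (landauOp B v - (z : ℂ) • v)‖ = ‖toL2 (landauOp B u - (z : ℂ) • u)‖ ∧
      ∀ d : ℝ, (∀ q, d ≤ |landauLevel B q - z|) →
        d * ‖toL2 u‖ ^ 2 ≤
          (inner ℂ (toL2 v) (toL2 (landauOp B u - (z : ℂ) • u))).re := by
  obtain ⟨f, hf, hfu⟩ := (Submodule.mem_iSup_iff_exists_finsupp _ _).1 hu
  set σ : ℕ → ℝ := fun q => if 0 ≤ landauLevel B q - z then 1 else -1 with hσ
  have hσ1 : ∀ q, σ q ^ 2 = 1 := fun q => by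
    simp only [hσ]; split_ifs <;> norm_num
  have hσ2 : ∀ q, σ q * (landauLevel B q - z) = |landauLevel B q - z| := fun q => by
    simp only [hσ]
    split_ifs with h
    · rw [one_mul, abs_of_nonneg h]
    · rw [abs_of_neg (not_le.1 h)]; ring
  have hop : ∀ α : ℕ → ℝ, landauOp B (∑ q ∈ f.support, (α q : ℂ) • f q) -
      (z : ℂ) • (∑ q ∈ f.support, (α q : ℂ) • f q) =
      ∑ q ∈ f.support, ((α q * (landauLevel B q - z) : ℝ) : ℂ) • f q := by
    intro α
    rw [map_sum, Finset.smul_sum, ← Finset.sum_sub_distrib]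
    refine Finset.sum_congr rfl fun q _ => ?_
    rw [map_smul, mem_landauEigenspace.1 (hf q)]
    push_cast; module
  have hu1 : u = ∑ q ∈ f.support, (((fun _ => 1 : ℕ → ℝ) q : ℝ) : ℂ) • f q := by
    rw [← hfu, Finsupp.sum]
    simp
  refine ⟨∑ q ∈ f.support, (σ q : ℂ) • f q, ?_, ?_, fun d hd => ?_⟩
  · rw [← sq_eq_sq₀ (norm_nonneg _) (norm_nonneg _), hu1, norm_sq_sum_landauEigenspace hB hf,
      norm_sq_sum_landauEigenspace hB hf]
    simp [hσ1]
  · rw [← sq_eq_sq₀ (norm_nonneg _) (norm_nonneg _), hu1, hop, hop,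
      norm_sq_sum_landauEigenspace hB hf, norm_sq_sum_landauEigenspace hB hf]
    simp [hσ1, mul_pow]
  · rw [hu1, hop, inner_sum_landauEigenspace hB hf, norm_sq_sum_landauEigenspace hB hf,
      Complex.ofReal_re, Finset.mul_sum]
    refine Finset.sum_le_sum fun q _ => ?_
    simp only [one_mul, one_pow, hσ2]
    exact mul_le_mul_of_nonneg_right (hd q) (sq_nonneg _)

theorem potentialMul_coeFn (V : Plane →ᵇ ℝ) (u : L2Plane) :
    potentialMul V u =ᵐ[volume] fun x => (V x : ℂ) * u x :=
  (memLp_potential_mul V u).coeFn_toLp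

theorem norm_potentialMul_le (V : Plane →ᵇ ℝ) (u : L2Plane) :
    ‖potentialMul V u‖ ≤ ‖V‖ * ‖u‖ := by
  refine Lp.norm_le_mul_norm_of_ae_le_mul ?_
  filter_upwards [potentialMul_coeFn V u] with x hx
  rw [hx, norm_mul, Complex.norm_real]
  exact mul_le_mul_of_nonneg_right (V.norm_coe_le_norm x) (norm_nonneg _)

theorem inner_potentialMul_left (V : Plane →ᵇ ℝ) (u v : L2Plane) :
    inner ℂ (potentialMul V u) v = inner ℂ u (potentialMul V v) := by
  rw [L2.inner_def, L2.inner_def]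
  refine integral_congr_ae ?_
  filter_upwards [potentialMul_coeFn V u, potentialMul_coeFn V v] with x h1 h2
  rw [h1, h2]
  simp only [RCLike.inner_apply, map_mul, Complex.conj_ofReal]
  ring

theorem norm_inner_potentialMul_le {V : Plane →ᵇ ℝ} {c ρ : ℝ} (hρ : 0 < ρ)
    (hV : ∀ x, |V x| ≤ c * japaneseBracket x ^ (-ρ)) (u v : 𝓢(Plane, ℂ)) :
    ‖inner ℂ (toL2 v) (potentialMul V (toL2 u))‖ ≤
      c * (weightedMass (fun x => japaneseBracket x ^ (-ρ)) u +
        weightedMass (fun x => japaneseBracket x ^ (-ρ)) v) / 2 := by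
  have hi : ∀ φ : 𝓢(Plane, ℂ), Integrable (fun x => japaneseBracket x ^ (-ρ) * ‖φ x‖ ^ 2) :=
    integrable_weight_mul_norm_sq (continuous_bracket_rpow ρ) (abs_bracket_rpow_le_one hρ)
  have hrhs : c * (weightedMass (fun x => japaneseBracket x ^ (-ρ)) u +
        weightedMass (fun x => japaneseBracket x ^ (-ρ)) v) / 2 =
      ∫ x, (c / 2) * (japaneseBracket x ^ (-ρ) * ‖u x‖ ^ 2 +
        japaneseBracket x ^ (-ρ) * ‖v x‖ ^ 2) := by
    rw [integral_const_mul, integral_add (hi u) (hi v), weightedMass, weightedMass]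
    ring
  rw [hrhs, L2.inner_def]
  refine norm_integral_le_of_norm_le (((hi u).add (hi v)).const_mul (c / 2)) ?_
  filter_upwards [potentialMul_coeFn V (toL2 u), toL2_coeFn u, toL2_coeFn v] with x h1 h2 h3
  rw [h1, h2, h3, RCLike.inner_apply, norm_mul, norm_mul, RCLike.norm_conj, Complex.norm_real,
    Real.norm_eq_abs]
  have h4 : ‖u x‖ * ‖v x‖ ≤ (‖u x‖ ^ 2 + ‖v x‖ ^ 2) / 2 := by
    nlinarith [sq_nonneg (‖u x‖ - ‖v x‖)]
  calc |V x| * ‖u x‖ * ‖v x‖ = |V x| * (‖u x‖ * ‖v x‖) := by ring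
    _ ≤ (c * japaneseBracket x ^ (-ρ)) * ((‖u x‖ ^ 2 + ‖v x‖ ^ 2) / 2) :=
        mul_le_mul (hV x) h4 (by positivity) ((abs_nonneg _).trans (hV x))
    _ = _ := by ring

theorem exists_lower_bound_on_landauSpan {B ρ : ℝ} (hB : 0 < B) (hρ0 : 0 < ρ) (hρ1 : ρ < 1)
    {V : Plane →ᵇ ℝ} (hV : ∃ c : ℝ, ∀ x : Plane, |V x| ≤ c * japaneseBracket x ^ (-ρ)) :
    ∃ K : ℝ, 0 < K ∧ ∀ z : ℝ, B ≤ z → (∀ q, K * z ^ (-(ρ / 2)) ≤ |landauLevel B q - z|) →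
      ∃ δ : ℝ, 0 < δ ∧ ∀ u ∈ landauSpan B, δ * ‖toL2 u‖ ≤
        ‖toL2 (landauOp B u) + potentialMul V (toL2 u) - (z : ℂ) • toL2 u‖ := by
  obtain ⟨c, hc⟩ := hV
  have hc0 : 0 ≤ c := by
    have h := (abs_nonneg _).trans (hc 0)
    have h1 : 0 < japaneseBracket 0 ^ (-ρ) :=
      Real.rpow_pos_of_pos (zero_lt_one.trans_le (one_le_japaneseBracket 0)) _
    exact nonneg_of_mul_nonneg_left h h1
  obtain ⟨K, hK, hmass⟩ := exists_weightedMass_bracket_le hB hρ0 hρ1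
    (M := 1 + ‖V‖) (by linarith [norm_nonneg V])
  refine ⟨c * K + 1, by positivity, fun z hz hd => ?_⟩
  have hz0 : 0 < z := hB.trans_le hz
  have hw : 0 < z ^ (-(ρ / 2)) := Real.rpow_pos_of_pos hz0 _
  refine ⟨min 1 (z ^ (-(ρ / 2))), lt_min one_pos hw, fun u hu => ?_⟩
  set f := toL2 (landauOp B u) + potentialMul V (toL2 u) - (z : ℂ) • toL2 u with hf
  rcases le_total ‖toL2 u‖ ‖f‖ with h | h
  · exact (mul_le_of_le_one_left (norm_nonneg _) (min_le_left _ _)).trans h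
  have hgf : toL2 (landauOp B u - (z : ℂ) • u) = f - potentialMul V (toL2 u) := by
    rw [hf, map_sub, map_smul]; abel
  have hg : ‖toL2 (landauOp B u - (z : ℂ) • u)‖ ≤ (1 + ‖V‖) * ‖toL2 u‖ := by
    rw [hgf]
    refine (norm_sub_le _ _).trans ?_
    linarith [norm_potentialMul_le V (toL2 u)]
  obtain ⟨v, hv1, hv2, hv3⟩ := exists_sign_reflection hB z hu
  have hmu := hmass z ‖toL2 u‖ u hz le_rfl hg
  have hmv := hmass z ‖toL2 u‖ v hz hv1.le (hv2.le.trans hg)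
  have h1 := hv3 _ hd
  rw [hgf, inner_sub_right, Complex.sub_re] at h1
  have h2 : (inner ℂ (toL2 v) f).re ≤ ‖toL2 u‖ * ‖f‖ := by
    rw [← hv1]; exact (Complex.re_le_norm _).trans (norm_inner_le_norm _ _)
  have h3 : -(inner ℂ (toL2 v) (potentialMul V (toL2 u))).re ≤
      c * (K * z ^ (-(ρ / 2)) * ‖toL2 u‖ ^ 2) := by
    refine (neg_le_abs _).trans ((Complex.abs_re_le_norm _).trans
      ((norm_inner_potentialMul_le hρ0 hc u v).trans ?_))
    have := mul_le_mul_of_nonneg_left (add_le_add hmu hmv) hc0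
    linarith
  rcases (norm_nonneg (toL2 u)).eq_or_lt with h0 | h0
  · rw [← h0, mul_zero]; exact norm_nonneg _
  have h4 : z ^ (-(ρ / 2)) * ‖toL2 u‖ ≤ ‖f‖ := by
    refine le_of_mul_le_mul_left ?_ h0
    linarith
  exact (mul_le_mul_of_nonneg_right (min_le_right _ _) h0.le).trans h4

/-! ### Bounded perturbations of symmetric surjective graphs -/

section Abstract

variable {E : Type*} [NormedAddCommGroup E] [InnerProductSpace ℂ E]

/-- Closed range theorem for a continuous operator on a closed graph that controls the graph norm
from below. -/
theorem range_eq_top_of_bound [CompleteSpace E] {F : Type*} [NormedAddCommGroup F] [NormedSpace ℂ F]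
    [CompleteSpace F] (S : F →L[ℂ] E) {K : ℝ} (hK : ∀ p, ‖p‖ ≤ K * ‖S p‖)
    (hd : ∀ y, (∀ p, inner ℂ y (S p) = 0) → y = 0) :
    LinearMap.range (S : F →ₗ[ℂ] E) = ⊤ := by
  have hanti : AntilipschitzWith (Real.toNNReal K) S :=
    AddMonoidHomClass.antilipschitz_of_bound S fun p =>
      (hK p).trans (mul_le_mul_of_nonneg_right (Real.le_coe_toNNReal K) (norm_nonneg _))
  have hclosed : IsClosed (LinearMap.range (S : F →ₗ[ℂ] E) : Set E) := by
    have := hanti.isClosed_range S.uniformContinuous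
    simpa [LinearMap.coe_range] using this
  rw [← hclosed.submodule_topologicalClosure_eq, Submodule.topologicalClosure_eq_top_iff,
    Submodule.eq_bot_iff]
  intro y hy
  refine hd y fun p => ?_
  rw [← inner_conj_symm, (Submodule.mem_orthogonal _ _).1 hy (S p) ⟨p, rfl⟩, map_zero]

/-- The map `(x, y) ↦ y + Vx - zx` on a graph `G`. -/
def perturbedGraphMap (G : Submodule ℂ (E × E)) (V : E →L[ℂ] E) (z : ℂ) : G →L[ℂ] E :=
  (ContinuousLinearMap.snd ℂ E E + V.comp (ContinuousLinearMap.fst ℂ E E) -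
    z • ContinuousLinearMap.fst ℂ E E).comp G.subtypeL

theorem perturbedGraphMap_apply (G : Submodule ℂ (E × E)) (V : E →L[ℂ] E) (z : ℂ) (p : G) :
    perturbedGraphMap G V z p = (p : E × E).2 + V (p : E × E).1 - z • (p : E × E).1 := rfl

/-- Let `G` be the graph of a closed symmetric operator `T` which is onto, hence self-adjoint, and
let `V` be bounded and symmetric. If `T + V - z` and `T + V - z̄` are bounded below, then `T + V - z`
has a bounded inverse. -/
theorem exists_resolvent_of_lower_bound [CompleteSpace E] {G : Submodule ℂ (E × E)}
    (hG : IsClosed (G : Set (E × E)))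
    (hsymm : ∀ p ∈ G, ∀ q ∈ G, inner ℂ p.2 q.1 = inner ℂ p.1 q.2)
    (hsurj : ∀ h, ∃ x, (x, h) ∈ G) {V : E →L[ℂ] E}
    (hV : ∀ x y, inner ℂ (V x) y = inner ℂ x (V y)) {z : ℂ} {δ : ℝ} (hδ : 0 < δ)
    (hz : ∀ p ∈ G, δ * ‖p.1‖ ≤ ‖p.2 + V p.1 - z • p.1‖)
    (hzc : ∀ p ∈ G, δ * ‖p.1‖ ≤ ‖p.2 + V p.1 - conj z • p.1‖) :
    ∃ R : E →L[ℂ] E, (∀ y, ∃ w, (R y, w) ∈ G ∧ w + V (R y) - z • R y = y) ∧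
      ∀ p ∈ G, R (p.2 + V p.1 - z • p.1) = p.1 := by
  have : CompleteSpace G := hG.completeSpace_coe
  set S := perturbedGraphMap G V z with hS
  have hfst : ∀ p : G, ‖(p : E × E).1‖ ≤ δ⁻¹ * ‖S p‖ := fun p => by
    rw [inv_mul_eq_div, le_div_iff₀ hδ, mul_comm]
    exact hz p p.2
  have hbound : ∀ p : G, ‖p‖ ≤ (δ⁻¹ + (1 + (‖V‖ + ‖z‖) * δ⁻¹)) * ‖S p‖ := by
    intro p
    have h1 := hfst p
    have h2 : ‖(p : E × E).2‖ ≤ (1 + (‖V‖ + ‖z‖) * δ⁻¹) * ‖S p‖ := by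
      have h3 : (p : E × E).2 = S p - V (p : E × E).1 + z • (p : E × E).1 := by
        rw [hS, perturbedGraphMap_apply]; abel
      rw [h3]
      calc _ ≤ ‖S p‖ + ‖V (p : E × E).1‖ + ‖z • (p : E × E).1‖ :=
            (norm_add_le _ _).trans (add_le_add_left (norm_sub_le _ _) _)
        _ ≤ ‖S p‖ + ‖V‖ * (δ⁻¹ * ‖S p‖) + ‖z‖ * (δ⁻¹ * ‖S p‖) := by
            rw [norm_smul]
            gcongr
            exact (V.le_opNorm _).trans (by gcongr)
        _ = _ := by ring
    have h4 : ‖p‖ = max ‖(p : E × E).1‖ ‖(p : E × E).2‖ := rfl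
    have h5 : 0 ≤ δ⁻¹ * ‖S p‖ := by positivity
    have h6 : 0 ≤ (1 + (‖V‖ + ‖z‖) * δ⁻¹) * ‖S p‖ := by positivity
    rw [h4, max_le_iff, add_mul]
    exact ⟨h1.trans (by linarith), h2.trans (by linarith)⟩
  have hrange : LinearMap.range (S : G →ₗ[ℂ] E) = ⊤ := by
    refine range_eq_top_of_bound S hbound fun y hy => ?_
    -- `y` is in the domain of the adjoint of `T`, which is the domain of `T` as `T` is onto.
    obtain ⟨y', hy'⟩ := hsurj (conj z • y - V y)
    have h1 : ∀ p ∈ G, inner ℂ (y - y') p.2 = 0 := by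
      intro p hp
      have h2 := hy ⟨p, hp⟩
      have h3 := hsymm _ hy' p hp
      rw [hS, perturbedGraphMap_apply, inner_sub_right, inner_add_right, inner_smul_right,
        ← hV] at h2
      simp only [inner_sub_left, inner_smul_left, Complex.conj_conj] at h2 h3 ⊢
      linear_combination h2 + h3
    have h4 : y = y' := by
      obtain ⟨x, hx⟩ := hsurj (y - y')
      exact sub_eq_zero.1 (inner_self_eq_zero.1 (h1 _ hx))
    rw [← h4] at hy'
    have h5 := hzc _ hy'
    simp only [sub_add_cancel, sub_self, norm_zero] at h5
    exact norm_eq_zero.1 (le_antisymm (by nlinarith) (norm_nonneg y))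
  have hker : LinearMap.ker (S : G →ₗ[ℂ] E) = ⊥ := by
    rw [LinearMap.ker_eq_bot']
    intro p hp
    have h := hbound p
    have hp' : S p = 0 := hp
    rw [hp', norm_zero, mul_zero] at h
    exact norm_le_zero_iff.1 h
  set e := ContinuousLinearEquiv.ofBijective S hker hrange with he
  refine ⟨(ContinuousLinearMap.fst ℂ E E).comp (G.subtypeL.comp (e.symm : E →L[ℂ] G)),
    fun y => ⟨((e.symm y : G) : E × E).2, (e.symm y).2, ?_⟩, fun p hp => ?_⟩
  · have h : S (e.symm y) = y := e.apply_symm_apply y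
    exact h
  · have h : e.symm (S ⟨p, hp⟩) = ⟨p, hp⟩ := e.symm_apply_apply ⟨p, hp⟩
    have h' : S ⟨p, hp⟩ = p.2 + V p.1 - z • p.1 := rfl
    rw [← h']
    simp [h]

/-- Symmetric operators are bounded below away from the real axis. -/
theorem abs_im_mul_norm_le {x y : E} {V : E →L[ℂ] E}
    (hV : ∀ x y, inner ℂ (V x) y = inner ℂ x (V y)) (hxy : inner ℂ y x = inner ℂ x y) (z : ℂ) :
    |z.im| * ‖x‖ ≤ ‖y + V x - z • x‖ := by
  have him : ∀ w : E, inner ℂ w x = inner ℂ x w → (inner ℂ x w).im = 0 := fun w hw => by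
    have h := inner_conj_symm (𝕜 := ℂ) x w
    rw [hw] at h
    exact Complex.conj_eq_iff_im.1 h
  have h1 : (inner ℂ x (y + V x - z • x)).im = -(z.im * ‖x‖ ^ 2) := by
    rw [inner_sub_right, inner_add_right, inner_smul_right, inner_self_eq_norm_sq_to_K,
      Complex.sub_im, Complex.add_im, him y hxy, him (V x) (hV x x)]
    have : (z * ((‖x‖ : ℝ) : ℂ) ^ 2).im = z.im * ‖x‖ ^ 2 := by
      rw [← Complex.ofReal_pow, Complex.im_mul_ofReal]
    linear_combination -this
  have h2 : |z.im| * ‖x‖ ^ 2 ≤ ‖x‖ * ‖y + V x - z • x‖ := by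
    rw [← abs_of_nonneg (sq_nonneg ‖x‖), ← abs_mul, ← abs_neg, ← h1]
    exact (Complex.abs_im_le_norm _).trans (norm_inner_le_norm _ _)
  rcases (norm_nonneg x).eq_or_lt with h0 | h0
  · rw [← h0, mul_zero]; exact norm_nonneg _
  · refine le_of_mul_le_mul_left ?_ h0
    linarith

end Abstract

/-! ### The graph of the Landau Hamiltonian -/

theorem mem_landauGraph {B : ℝ} {p : L2Plane × L2Plane} :
    p ∈ landauGraph B ↔ ∃ φ : 𝓢(Plane, ℂ), p = (toL2 φ, toL2 (landauOp B φ)) := by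
  constructor
  · rintro ⟨φ, h1, h2⟩
    refine ⟨φ, Prod.ext (Lp.ext (h1.trans (toL2_coeFn φ).symm)) (Lp.ext (h2.trans ?_))⟩
    rw [← landauOp_eq_landauExpr]
    exact (toL2_coeFn _).symm
  · rintro ⟨φ, rfl⟩
    refine ⟨φ, toL2_coeFn φ, ?_⟩
    rw [← landauOp_eq_landauExpr]
    exact toL2_coeFn _

/-- The closure of the graph of the Landau Hamiltonian on the Schwartz space. -/
def closedLandauGraph (B : ℝ) : Submodule ℂ (L2Plane × L2Plane) :=
  (landauGraph B).topologicalClosure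

theorem closedLandauGraph_induction {B : ℝ} {P : L2Plane × L2Plane → Prop}
    (hP : IsClosed {p | P p}) (h : ∀ φ : 𝓢(Plane, ℂ), P (toL2 φ, toL2 (landauOp B φ)))
    {p : L2Plane × L2Plane} (hp : p ∈ closedLandauGraph B) : P p := by
  have : (landauGraph B : Set (L2Plane × L2Plane)) ⊆ {p | P p} := by
    intro q hq
    obtain ⟨φ, rfl⟩ := mem_landauGraph.1 hq
    exact h φ
  exact closure_minimal this hP hp

theorem mem_closedLandauGraph (B : ℝ) (φ : 𝓢(Plane, ℂ)) :
    (toL2 φ, toL2 (landauOp B φ)) ∈ closedLandauGraph B :=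
  (landauGraph B).le_topologicalClosure (mem_landauGraph.2 ⟨φ, rfl⟩)

theorem closedLandauGraph_symmetric {B : ℝ} {p q : L2Plane × L2Plane}
    (hp : p ∈ closedLandauGraph B) (hq : q ∈ closedLandauGraph B) :
    inner ℂ p.2 q.1 = inner ℂ p.1 q.2 := by
  refine closedLandauGraph_induction (P := fun p => inner ℂ p.2 q.1 = inner ℂ p.1 q.2)
    (isClosed_eq (by fun_prop) (by fun_prop)) (fun φ => ?_) hp
  exact closedLandauGraph_induction
    (P := fun q => inner ℂ (toL2 (landauOp B φ)) q.1 = inner ℂ (toL2 φ) q.2)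
    (isClosed_eq (by fun_prop) (by fun_prop)) (fun ψ => inner_landauOp_left B φ ψ) hq

theorem mul_norm_le_of_mem_closedLandauGraph {B : ℝ} {p : L2Plane × L2Plane}
    (hp : p ∈ closedLandauGraph B) : B * ‖p.1‖ ^ 2 ≤ (inner ℂ p.1 p.2).re :=
  closedLandauGraph_induction (P := fun p => B * ‖p.1‖ ^ 2 ≤ (inner ℂ p.1 p.2).re)
    (isClosed_le (by fun_prop) (Complex.continuous_re.comp (by fun_prop)))
    (fun φ => mul_norm_sq_le_re_inner_landauOp B φ) hp

theorem mul_norm_le_norm_of_mem_closedLandauGraph {B : ℝ} {p : L2Plane × L2Plane}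
    (hp : p ∈ closedLandauGraph B) : B * ‖p.1‖ ≤ ‖p.2‖ := by
  have h := (mul_norm_le_of_mem_closedLandauGraph hp).trans
    ((Complex.re_le_norm _).trans (norm_inner_le_norm _ _))
  rcases (norm_nonneg p.1).eq_or_lt with h0 | h0
  · rw [← h0, mul_zero]; exact norm_nonneg _
  · refine le_of_mul_le_mul_left ?_ h0
    linarith

theorem exists_mem_closedLandauGraph {B : ℝ} (hB : 0 < B) (h : L2Plane) :
    ∃ x, (x, h) ∈ closedLandauGraph B := by
  have : CompleteSpace (closedLandauGraph B) :=
    (landauGraph B).isClosed_topologicalClosure.completeSpace_coe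
  set S : closedLandauGraph B →L[ℂ] L2Plane :=
    (ContinuousLinearMap.snd ℂ L2Plane L2Plane).comp (closedLandauGraph B).subtypeL with hS
  have hb : ∀ p : closedLandauGraph B, ‖p‖ ≤ (B⁻¹ + 1) * ‖S p‖ := by
    intro p
    have h1 : ‖(p : L2Plane × L2Plane).1‖ ≤ B⁻¹ * ‖S p‖ := by
      rw [inv_mul_eq_div, le_div_iff₀ hB, mul_comm]
      exact mul_norm_le_norm_of_mem_closedLandauGraph p.2
    have h2 : ‖(p : L2Plane × L2Plane).2‖ = ‖S p‖ := rfl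
    have h3 : ‖p‖ = max ‖(p : L2Plane × L2Plane).1‖ ‖(p : L2Plane × L2Plane).2‖ := rfl
    have h4 : 0 ≤ B⁻¹ * ‖S p‖ := by positivity
    rw [h3, max_le_iff, add_mul, one_mul]
    exact ⟨h1.trans (by linarith [norm_nonneg (S p)]), h2.le.trans (by linarith)⟩
  have hr : LinearMap.range (S : closedLandauGraph B →ₗ[ℂ] L2Plane) = ⊤ := by
    refine range_eq_top_of_bound S hb fun y hy => eq_zero_of_inner_landauSpan_eq_zero hB ?_
    intro φ hφ
    obtain ⟨ψ, -, rfl⟩ := exists_landauOp_eq hB hφ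
    rw [← inner_conj_symm, show inner ℂ y (toL2 (landauOp B ψ)) = 0 from
      hy ⟨_, mem_closedLandauGraph B ψ⟩, map_zero]
  obtain ⟨p, hp⟩ := LinearMap.range_eq_top.1 hr h
  refine ⟨(p : L2Plane × L2Plane).1, ?_⟩
  have hp' : (p : L2Plane × L2Plane).2 = h := hp
  rw [← hp']
  exact p.2

theorem landauCore_isClosable (B : ℝ) : (landauCore B).IsClosable := by
  refine ⟨(closedLandauGraph B).toLinearPMap, ?_⟩
  rw [Submodule.toLinearPMap_graph_eq, landauCore, Submodule.toLinearPMap_graph_eq]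
  · rfl
  · exact landauGraph_functional B
  · intro p hp h0
    refine denseRange_toL2.eq_zero_of_inner_left ℂ fun φ => ?_
    have h := closedLandauGraph_symmetric hp (mem_closedLandauGraph B φ)
    rw [h0, inner_zero_left] at h
    exact h

theorem landauHamiltonian_graph (B : ℝ) : (landauHamiltonian B).graph = closedLandauGraph B := by
  rw [landauHamiltonian, ← (landauCore_isClosable B).graph_closure_eq_closure_graph, landauCore,
    Submodule.toLinearPMap_graph_eq _ (landauGraph_functional B)]
  rfl

/-- The finite sums of eigenfunctions are a core, since they are dense and `H₀ ≥ B` maps them onto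
themselves. -/
theorem closedLandauGraph_induction_landauSpan {B : ℝ} (hB : 0 < B)
    {P : L2Plane × L2Plane → Prop} (hP : IsClosed {p | P p})
    (h : ∀ φ ∈ landauSpan B, P (toL2 φ, toL2 (landauOp B φ)))
    {p : L2Plane × L2Plane} (hp : p ∈ closedLandauGraph B) : P p := by
  refine closedLandauGraph_induction hP (fun φ => ?_) hp
  refine hP.closure_subset (Metric.mem_closure_iff.2 fun ε hε => ?_)
  obtain ⟨_, ⟨χ, hχ, rfl⟩, hdist⟩ := Metric.mem_closure_iff.1
    (dense_map_landauSpan hB (toL2 (landauOp B φ))) (min ε (B * ε)) (by positivity)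
  obtain ⟨ψ, hψ, rfl⟩ := exists_landauOp_eq hB hχ
  refine ⟨_, h ψ hψ, ?_⟩
  rw [dist_eq_norm] at hdist
  have h1 := mul_norm_le_norm_of_mem_closedLandauGraph
    ((closedLandauGraph B).sub_mem (mem_closedLandauGraph B φ) (mem_closedLandauGraph B ψ))
  rw [Prod.fst_sub, Prod.snd_sub] at h1
  rw [Prod.dist_eq, dist_eq_norm, dist_eq_norm, max_lt_iff]
  refine ⟨?_, hdist.trans_le (min_le_left _ _)⟩
  exact lt_of_mul_lt_mul_left (h1.trans_lt (hdist.trans_le (min_le_right _ _))) hB.le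

/-! ### The spectrum of the perturbed operator -/

/-- `potentialMul V` as a bounded operator. -/
def potentialCLM (V : Plane →ᵇ ℝ) : L2Plane →L[ℂ] L2Plane :=
  (potentialMul V).mkContinuous ‖V‖ (norm_potentialMul_le V)

theorem potentialCLM_apply (V : Plane →ᵇ ℝ) (u : L2Plane) :
    potentialCLM V u = potentialMul V u := rfl

theorem mem_operatorResolventSet_of_lower_bound {B : ℝ} (hB : 0 < B) (V : Plane →ᵇ ℝ) {z : ℂ}
    {δ : ℝ} (hδ : 0 < δ)
    (hz : ∀ p ∈ closedLandauGraph B, δ * ‖p.1‖ ≤ ‖p.2 + potentialCLM V p.1 - z • p.1‖)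
    (hzc : ∀ p ∈ closedLandauGraph B, δ * ‖p.1‖ ≤ ‖p.2 + potentialCLM V p.1 - conj z • p.1‖) :
    z ∈ operatorResolventSet (perturbedLandau B V) := by
  obtain ⟨R, hR1, hR2⟩ := exists_resolvent_of_lower_bound
    (landauGraph B).isClosed_topologicalClosure
    (fun p hp q hq => closedLandauGraph_symmetric hp hq) (exists_mem_closedLandauGraph hB)
    (V := potentialCLM V) (inner_potentialMul_left V) hδ hz hzc
  refine ⟨R, fun y => ?_, fun x => ?_⟩
  · obtain ⟨w, hw, hwy⟩ := hR1 y
    have hw' : (R y, w) ∈ (landauHamiltonian B).graph := by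
      rw [landauHamiltonian_graph]; exact hw
    obtain ⟨x, hx1, hx2⟩ := (LinearPMap.mem_graph_iff _).1 hw'
    have hmem : R y ∈ (landauHamiltonian B).domain := by
      have h := x.2
      rwa [hx1] at h
    refine ⟨hmem, ?_⟩
    have hx : x = ⟨R y, hmem⟩ := Subtype.ext hx1
    have h1 : landauHamiltonian B ⟨R y, hmem⟩ = w := by rw [← hx]; exact hx2
    have h2 : perturbedLandau B V ⟨R y, hmem⟩ =
        potentialMul V (R y) + landauHamiltonian B ⟨R y, hmem⟩ := rfl
    rw [h2, h1, ← potentialCLM_apply, add_comm]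
    exact hwy
  · have hx : ((x : L2Plane), landauHamiltonian B x) ∈ closedLandauGraph B := by
      rw [← landauHamiltonian_graph]; exact (landauHamiltonian B).mem_graph x
    have h1 := hR2 _ hx
    have h2 : perturbedLandau B V x =
        potentialMul V (x : L2Plane) + landauHamiltonian B x := rfl
    rw [h2, add_comm, ← potentialCLM_apply]
    exact h1

theorem mem_operatorResolventSet_of_im_ne_zero {B : ℝ} (hB : 0 < B) (V : Plane →ᵇ ℝ) {z : ℂ}
    (hz : z.im ≠ 0) : z ∈ operatorResolventSet (perturbedLandau B V) := by
  refine mem_operatorResolventSet_of_lower_bound hB V (abs_pos.2 hz)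
    (fun p hp => abs_im_mul_norm_le (inner_potentialMul_left V)
      (closedLandauGraph_symmetric hp hp) z) (fun p hp => ?_)
  have h := abs_im_mul_norm_le (V := potentialCLM V) (inner_potentialMul_left V)
    (closedLandauGraph_symmetric hp hp) (conj z)
  rwa [Complex.conj_im, abs_neg] at h

theorem mem_operatorResolventSet_of_real {B : ℝ} (hB : 0 < B) (V : Plane →ᵇ ℝ) {z δ : ℝ}
    (hδ : 0 < δ)
    (hz : ∀ p ∈ closedLandauGraph B,
      δ * ‖p.1‖ ≤ ‖p.2 + potentialCLM V p.1 - (z : ℂ) • p.1‖) :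
    (z : ℂ) ∈ operatorResolventSet (perturbedLandau B V) :=
  mem_operatorResolventSet_of_lower_bound hB V hδ hz (by simpa only [Complex.conj_ofReal] using hz)

theorem mem_operatorResolventSet_of_lt {B : ℝ} (hB : 0 < B) (V : Plane →ᵇ ℝ) {z : ℝ}
    (hz : z < B - ‖V‖) : (z : ℂ) ∈ operatorResolventSet (perturbedLandau B V) := by
  refine mem_operatorResolventSet_of_real hB V (δ := B - ‖V‖ - z) (by linarith) fun p hp => ?_
  have h1 := mul_norm_le_of_mem_closedLandauGraph hp
  have h2 : -(inner ℂ p.1 (potentialCLM V p.1)).re ≤ ‖V‖ * ‖p.1‖ ^ 2 := by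
    refine (neg_le_abs _).trans ((Complex.abs_re_le_norm _).trans
      ((norm_inner_le_norm _ _).trans ?_))
    have := mul_le_mul_of_nonneg_left (norm_potentialMul_le V p.1) (norm_nonneg p.1)
    rw [potentialCLM_apply]
    linarith
  have h3 : (inner ℂ p.1 (p.2 + potentialCLM V p.1 - (z : ℂ) • p.1)).re =
      (inner ℂ p.1 p.2).re + (inner ℂ p.1 (potentialCLM V p.1)).re - z * ‖p.1‖ ^ 2 := by
    rw [inner_sub_right, inner_add_right, inner_smul_right, inner_self_eq_norm_sq_to_K,
      Complex.sub_re, Complex.add_re]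
    have : ((z : ℂ) * ((‖p.1‖ : ℝ) : ℂ) ^ 2).re = z * ‖p.1‖ ^ 2 := by
      rw [← Complex.ofReal_pow, Complex.re_ofReal_mul, Complex.ofReal_re]
    linear_combination -this
  have h4 : (inner ℂ p.1 (p.2 + potentialCLM V p.1 - (z : ℂ) • p.1)).re ≤
      ‖p.1‖ * ‖p.2 + potentialCLM V p.1 - (z : ℂ) • p.1‖ :=
    (Complex.re_le_norm _).trans (norm_inner_le_norm _ _)
  rcases (norm_nonneg p.1).eq_or_lt with h0 | h0
  · rw [← h0, mul_zero]; exact norm_nonneg _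
  · refine le_of_mul_le_mul_left ?_ h0
    linarith

/-- If `z` keeps the distance `C λ_q^{-ρ/2}` from every level `λ_q`, then it keeps a distance
`C (4z)^{-ρ/2}` from all of them: the levels above `4z` are further from `z` than the last level
below `z`. -/
theorem le_abs_landauLevel_sub {B ρ C z : ℝ} (hB : 0 < B) (hρ : 0 < ρ) (hC : 0 ≤ C) (hz : B ≤ z)
    (h : ∀ q, C * landauLevel B q ^ (-(ρ / 2)) ≤ |landauLevel B q - z|) (q : ℕ) :
    C * (4 * z) ^ (-(ρ / 2)) ≤ |landauLevel B q - z| := by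
  have hz0 : 0 < z := hB.trans_le hz
  have hmono : ∀ p, landauLevel B p ≤ 4 * z →
      C * (4 * z) ^ (-(ρ / 2)) ≤ |landauLevel B p - z| := fun p hp =>
    (mul_le_mul_of_nonneg_left (Real.rpow_le_rpow_of_nonpos (landauLevel_pos hB p) hp
      (by linarith)) hC).trans (h p)
  rcases le_or_gt (landauLevel B q) (4 * z) with hq | hq
  · exact hmono q hq
  · set p := ⌊(z / B - 1) / 2⌋₊ with hp
    have hzB : 1 ≤ z / B := (one_le_div hB).2 hz
    have h1 : (p : ℝ) ≤ (z / B - 1) / 2 := Nat.floor_le (by linarith)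
    have h2 : (z / B - 1) / 2 < p + 1 := Nat.lt_floor_add_one _
    have hzz : z = B * (z / B) := by field_simp
    have h3 : landauLevel B p ≤ z := by
      rw [landauLevel]
      calc B * (2 * (p : ℝ) + 1) ≤ B * (z / B) := by gcongr; linarith
        _ = z := hzz.symm
    have h4 : z - 2 * B ≤ landauLevel B p := by
      have : B * (z / B - 2) ≤ B * (2 * (p : ℝ) + 1) :=
        mul_le_mul_of_nonneg_left (by linarith) hB.le
      rw [landauLevel]
      linarith
    refine (hmono p (by linarith)).trans ?_
    rw [abs_of_nonpos (by linarith), abs_of_nonneg (by linarith)]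
    linarith

theorem proposition2p1 (B : ℝ) (hB : 0 < B) (ρ : ℝ) (hρ0 : 0 < ρ) (hρ1 : ρ < 1)
    (V : Plane →ᵇ ℝ)
    (hV : ∃ c : ℝ, ∀ x : Plane, |V x| ≤ c * japaneseBracket x ^ (-ρ)) :
    ∃ C : ℝ, 0 < C ∧
      operatorSpectrum (perturbedLandau B V) ⊆
        ⋃ q : ℕ, Complex.ofReal '' Ioo
          (landauLevel B q - C * landauLevel B q ^ (-(ρ / 2)))
          (landauLevel B q + C * landauLevel B q ^ (-(ρ / 2))) := by
  obtain ⟨K, hK, hbound⟩ := exists_lower_bound_on_landauSpan hB hρ0 hρ1 hV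
  -- The first summand handles `z ≥ B`; the second one makes the interval around `λ₀ = B` so long
  -- that it covers the part of the spectrum below `B`, which is bounded below by `B - ‖V‖`.
  set C : ℝ := K * 4 ^ (ρ / 2) + (‖V‖ + 1) * B ^ (ρ / 2) with hC
  have hC0 : 0 < C := by have := norm_nonneg V; positivity
  refine ⟨C, hC0, fun w hw => ?_⟩
  by_contra hout
  refine hw ?_
  by_cases him : w.im = 0
  swap
  · exact mem_operatorResolventSet_of_im_ne_zero hB V him
  obtain ⟨z, rfl⟩ : ∃ z : ℝ, (z : ℂ) = w := ⟨w.re, Complex.ext rfl (by simp [him])⟩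
  have hfar : ∀ q, C * landauLevel B q ^ (-(ρ / 2)) ≤ |landauLevel B q - z| := by
    intro q
    by_contra hlt
    rw [not_le, abs_lt] at hlt
    exact hout (mem_iUnion.2 ⟨q, z, ⟨by linarith, by linarith⟩, rfl⟩)
  rcases lt_or_ge z B with hz | hz
  · refine mem_operatorResolventSet_of_lt hB V ?_
    have h0 := hfar 0
    have hl : landauLevel B 0 = B := by rw [landauLevel]; norm_num
    rw [hl, abs_of_pos (by linarith)] at h0
    have h1 : ‖V‖ + 1 ≤ C * B ^ (-(ρ / 2)) := by
      have h2 : (‖V‖ + 1) * B ^ (ρ / 2) * B ^ (-(ρ / 2)) = ‖V‖ + 1 := by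
        rw [mul_assoc, ← Real.rpow_add hB, add_neg_cancel, Real.rpow_zero, mul_one]
      have h3 : 0 ≤ K * 4 ^ (ρ / 2) * B ^ (-(ρ / 2)) := by positivity
      rw [hC, add_mul]
      linarith
    linarith
  · have hz0 : 0 < z := hB.trans_le hz
    obtain ⟨δ, hδ, hδz⟩ := hbound z hz fun q => by
      refine le_trans ?_ (le_abs_landauLevel_sub hB hρ0 hC0.le hz hfar q)
      have h1 : K * 4 ^ (ρ / 2) ≤ C := by
        have : 0 ≤ (‖V‖ + 1) * B ^ (ρ / 2) := by have := norm_nonneg V; positivity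
        linarith
      have h2 : (4 : ℝ) ^ (ρ / 2) * 4 ^ (-(ρ / 2)) = 1 := by
        rw [← Real.rpow_add (by norm_num), add_neg_cancel, Real.rpow_zero]
      calc K * z ^ (-(ρ / 2)) = K * (4 ^ (ρ / 2) * 4 ^ (-(ρ / 2))) * z ^ (-(ρ / 2)) := by
            rw [h2, mul_one]
        _ = K * 4 ^ (ρ / 2) * (4 * z) ^ (-(ρ / 2)) := by
            rw [Real.mul_rpow (by norm_num) hz0.le]; ring
        _ ≤ C * (4 * z) ^ (-(ρ / 2)) := by gcongr
    refine mem_operatorResolventSet_of_real hB V hδ fun p hp => ?_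
    exact closedLandauGraph_induction_landauSpan hB
      (P := fun p => δ * ‖p.1‖ ≤ ‖p.2 + potentialCLM V p.1 - (z : ℂ) • p.1‖)
      (isClosed_le (by fun_prop) (by fun_prop)) hδz hp

end
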